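/- Let $K$ be a field of characteristic zero and let $A=\bigoplus_{n\ge 0}A_n$ be a standard graded Artinian Gorenstein $K$-algebra (that is, $A$ is commutative and Artinian, $A_0=K$, $A$ is generated as a $K$-algebra by the finite-dimensional space $A_1$, and the socle $0:\bigoplus_{n>0}A_n$ is one-dimensional over $K$). Let $z\in A_1$ be a linear form. Let $f_1>f_2>\dots>f_s>0$ be the distinct sizes of the Jordan blocks of the nilpotent endomorphism $\times z:A\to A$, and put $f_{s+1}=0$. For $1\le i\le s$ let $$U_i=\frac{(0:z^{f_i})+(z)}{(0:z^{f_{i+1}})+(z)}$$ be the $i$-th central simple module of $(A,z)$, a graded $A$-module with the grading induced from $A$, and let $\tilde U_i=U_i\otimes_K K[t]/(t^{f_i})$, where $t$ has degree $1$, graded by total degree and regarded as a graded module over $A\otimes_K K[t]$. A finite graded module $V=\bigoplus_{n=a}^{b}V_n$ with $V_a\ne 0$, $V_b\neq 0$ over a graded $K$-algebra $R$ has the strong Lefschetz property (SLP) if there is an element $g\in R_1$ such that $\times g^{\,b-a-2i}:V_{a+i}\to V_{b-i}$ is bijective for all $i=0,1,\dots,\lfloor (b-a)/2\rfloor$. If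 every central simple module $U_1,\dots,U_s$ has the SLP as a graded $A$-module, then $\tilde U=\bigoplus_{i=1}^s\tilde U_i$ has the SLP as a graded $A\otimes_K K[t]$-module. -/

import Mathlib

open scoped TensorProduct Polynomial DirectSum

noncomputable section

namespace CSM

universe u v w w'

/-! ### Standard graded algebras and the Gorenstein property -/

section Algebras

variable (K : Type u) [Field K] {A : Type v} [CommRing A] [Algebra K A]
variable (𝒜 : ℕ → Submodule K A)

/-- The graded `K`-algebra `A = ⨁ₙ 𝒜 n` is standard graded: `A₀ = K · 1`, and `A` is generated as a
`K`-algebra by the finite-dimensional space `A₁` of linear forms. -/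
structure IsStandardGraded [GradedAlgebra 𝒜] : Prop where
  degree_zero : 𝒜 0 = Submodule.span K {(1 : A)}
  generated : Algebra.adjoin K (𝒜 1 : Set A) = ⊤
  finite_one : Module.Finite K (𝒜 1)

/-- The socle `0 : 𝔪` of a graded algebra, where `𝔪 = ⨁_{n > 0} 𝒜 n`. -/
def socle [GradedAlgebra 𝒜] : Ideal A :=
  (⊥ : Ideal A).colon ((HomogeneousIdeal.irrelevant 𝒜).toIdeal : Set A)

/-- An Artinian standard graded `K`-algebra is Gorenstein if its socle is one-dimensional
over `K`. -/
def IsArtinianGorenstein [GradedAlgebra 𝒜] : Prop :=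
  IsArtinianRing A ∧ Module.finrank K (socle K 𝒜) = 1

end Algebras

/-! ### Jordan block sizes of a nilpotent endomorphism -/

/-- The Jordan canonical form of the nilpotent endomorphism `T` consists of exactly `m i` Jordan
blocks `J(0, f i)` for each `i`, where `f 0 > f 1 > ⋯` are positive and every `m i` is positive.
The basis vector with index `⟨i, j, k⟩` is the `k`-th vector of the `j`-th block of size `f i`. -/
structure HasJordanBlockSizes {K : Type u} [Field K] {V : Type w} [AddCommGroup V] [Module K V]
    (T : V →ₗ[K] V) {s : ℕ} (f m : Fin s → ℕ) : Prop where
  strictAnti : StrictAnti f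
  size_pos : ∀ i, 0 < f i
  mult_pos : ∀ i, 0 < m i
  exists_basis : ∃ b : Module.Basis (Σ i : Fin s, Fin (m i) × Fin (f i)) K V,
    ∀ (i : Fin s) (j : Fin (m i)) (k : Fin (f i)),
      T (b ⟨i, j, k⟩) = if h : (k : ℕ) + 1 < f i then b ⟨i, j, ⟨k + 1, h⟩⟩ else 0

/-! ### Central simple modules -/

section CentralSimple

variable {A : Type v} [CommRing A]

/-- The ideal `(0 : zᵏ) + (z)`. -/
def annPowAdd (z : A) (k : ℕ) : Ideal A :=
  (⊥ : Ideal A).colon {z ^ k} ⊔ Ideal.span {z}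

/-- `f_{i+1}`, with the convention that it is `0` if `i` is the last index. -/
def nextSize {s : ℕ} (f : Fin s → ℕ) (i : Fin s) : ℕ :=
  if h : (i : ℕ) + 1 < s then f ⟨i + 1, h⟩ else 0

/-- The `i`-th central simple module
`U_i = ((0 : z^{f_i}) + (z)) / ((0 : z^{f_{i+1}}) + (z))`. -/
abbrev CentralSimpleModule (z : A) {s : ℕ} (f : Fin s → ℕ) (i : Fin s) : Type v :=
  annPowAdd z (f i) ⧸ (annPowAdd z (nextSize f i)).submoduleOf (annPowAdd z (f i))

/-- The grading of `U_i` induced by the grading of `A`: the degree `n` piece consists of the classes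
of the elements of `(0 : z^{f_i}) + (z)` that are homogeneous of degree `n`. -/
def centralSimpleGrading {K : Type u} [Field K] [Algebra K A] (𝒜 : ℕ → Submodule K A)
    (z : A) {s : ℕ} (f : Fin s → ℕ) (i : Fin s) (n : ℕ) :
    Submodule K (CentralSimpleModule z f i) :=
  ((𝒜 n).comap ((annPowAdd z (f i)).subtype.restrictScalars K)).map
    (((annPowAdd z (nextSize f i)).submoduleOf (annPowAdd z (f i))).mkQ.restrictScalars K)

end CentralSimple

/-! ### The strong Lefschetz property of a graded module -/

/-- The graded module `V = ⨁ₙ 𝒱 n` over the graded `K`-algebra `R = ⨁ₙ ℛ n` has the strong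
Lefschetz property: `V` lives exactly in degrees `a, …, b` with `V_a ≠ 0`, `V_b ≠ 0`, and for some
linear form `g` all maps `× g^{b-a-2i} : V_{a+i} → V_{b-i}`, `0 ≤ i ≤ ⌊(b-a)/2⌋`, are bijective. -/
def HasSLP {K : Type u} [Field K] {R : Type v} [CommRing R] [Algebra K R] (ℛ : ℕ → Submodule K R)
    {V : Type w} [AddCommGroup V] [Module K V] [Module R V] (𝒱 : ℕ → Submodule K V) : Prop :=
  ∃ a b : ℕ, a ≤ b ∧ 𝒱 a ≠ ⊥ ∧ 𝒱 b ≠ ⊥ ∧ (∀ n, 𝒱 n ≠ ⊥ → a ≤ n ∧ n ≤ b) ∧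
    ∃ g ∈ ℛ 1, ∀ i : ℕ, 2 * i ≤ b - a →
      Set.BijOn (fun x : V => g ^ (b - a - 2 * i) • x) (𝒱 (a + i) : Set V) (𝒱 (b - i) : Set V)

/-! ### External tensor products, direct sums, and their gradings -/

section Tensor

variable (K : Type u) [Field K] (M : Type w) [AddCommGroup M] [Module K M]
  (N : Type w') [AddCommGroup N] [Module K N]

/-- `M ⊗_K N`, regarded as a module over `A ⊗_K B` when `M` is an `A`-module and `N` is a
`B`-module. -/
def ExternalTensor : Type (max w w') := M ⊗[K] N

instance : AddCommGroup (ExternalTensor K M N) := inferInstanceAs (AddCommGroup (M ⊗[K] N))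

instance : Module K (ExternalTensor K M N) := inferInstanceAs (Module K (M ⊗[K] N))

variable {K}

/-- The action `(a ⊗ b) • (x ⊗ y) = (a • x) ⊗ (b • y)`. -/
def tensorAction (A : Type v) [CommRing A] [Algebra K A] [Module A M] [IsScalarTower K A M]
    (B : Type*) [CommRing B] [Algebra K B] [Module B N] [IsScalarTower K B N] :
    A ⊗[K] B →ₐ[K] Module.End K (M ⊗[K] N) :=
  (Module.endTensorEndAlgHom (R := K) (S := K) (A := K) (M := M) (N := N)).comp
    (Algebra.TensorProduct.map (Algebra.lsmul K K M) (Algebra.lsmul K K N))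

theorem tensorAction_tmul (A : Type v) [CommRing A] [Algebra K A] [Module A M]
    [IsScalarTower K A M] (B : Type*) [CommRing B] [Algebra K B] [Module B N]
    [IsScalarTower K B N] (a : A) (b : B) (x : M) (y : N) :
    tensorAction M N A B (a ⊗ₜ b) (x ⊗ₜ y) = (a • x) ⊗ₜ[K] (b • y) :=
  rfl

instance {A : Type v} [CommRing A] [Algebra K A] [Module A M] [IsScalarTower K A M]
    {B : Type*} [CommRing B] [Algebra K B] [Module B N] [IsScalarTower K B N] :
    Module (A ⊗[K] B) (ExternalTensor K M N) :=
  Module.compHom (M ⊗[K] N) (tensorAction M N A B).toRingHom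

variable {M N}

/-- The degree `n` piece `∑_{p+q=n} 𝒱 p ⊗ 𝒲 q` of a tensor product of graded spaces. -/
def tensorGrading (𝒱 : ℕ → Submodule K M) (𝒲 : ℕ → Submodule K N) (n : ℕ) :
    Submodule K (M ⊗[K] N) :=
  ⨆ p ∈ Finset.HasAntidiagonal.antidiagonal n, Submodule.map₂ (TensorProduct.mk K M N) (𝒱 p.1) (𝒲 p.2)

/-- The degree `n` piece `⨁_i (M_i)_n` of a direct sum of graded spaces. -/
def directSumGrading {ι : Type*} {M : ι → Type w} [∀ i, AddCommGroup (M i)]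
    [∀ i, Module K (M i)] (𝒱 : ∀ i, ℕ → Submodule K (M i)) (n : ℕ) :
    Submodule K (⨁ i, M i) :=
  ⨅ i, (𝒱 i n).comap (DirectSum.component K ι M i)

end Tensor

section Tilde

variable (K : Type u) [Field K]

/-- The degree `n` piece `K · tⁿ` of `K[t]`. -/
def polyGrading (n : ℕ) : Submodule K K[X] := Submodule.span K {Polynomial.X ^ n}

/-- The truncated polynomial ring `K[t]/(t^d)`. -/
abbrev TruncPoly (d : ℕ) : Type u := K[X] ⧸ Ideal.span {(Polynomial.X : K[X]) ^ d}

/-- The degree `n` piece of `K[t]/(t^d)`, the image of `K · tⁿ`. -/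
def truncGrading (d n : ℕ) : Submodule K (TruncPoly K d) :=
  (polyGrading K n).map (Ideal.Quotient.mkₐ K (Ideal.span {(Polynomial.X : K[X]) ^ d})).toLinearMap

variable {A : Type v} [CommRing A] [Algebra K A]

/-- `Ũ_i = U_i ⊗_K K[t]/(t^{f_i})`, a module over `A ⊗_K K[t]`. -/
abbrev TildeModule (z : A) {s : ℕ} (f : Fin s → ℕ) (i : Fin s) : Type (max v u) :=
  ExternalTensor K (CentralSimpleModule z f i) (TruncPoly K (f i))

variable {K}

/-- The grading of `Ũ_i` by total degree. -/
def tildeGrading (𝒜 : ℕ → Submodule K A) (z : A) {s : ℕ} (f : Fin s → ℕ) (i : Fin s) (n : ℕ) :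
    Submodule K (TildeModule K z f i) :=
  tensorGrading (centralSimpleGrading 𝒜 z f i) (truncGrading K (f i)) n

end Tilde

end CSM

end

/-!
The strong Lefschetz property of a graded space `V = ⨁ₙ 𝒱 n` with respect to an operator `E` of
degree one says exactly that `E` is the raising operator of a representation of `sl₂` on `V` whose
weight spaces are the pieces `𝒱 n`, with weight `2 n - c` for some `c`. One direction
(`IsSl2.bijOn`) is the classical fact that `E ^ k` maps the space of weight `-k` bijectively onto
the space of weight `k`. For the other one (`exists_graded_lowering`), the lowering operator is
constructed by splitting off the strings that start in the lowest degree. Representations of `sl₂`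
can be tensored and added (`IsGradedSl2.tensor`, `IsGradedSl2.directSum`), and the raising operator
of `U ⊗ K[t]/(t^d)` is multiplication by `g ⊗ 1 + 1 ⊗ t` when `g` is a Lefschetz element of `U`. It
remains to see that the summands `Ũ_i` fit together, which requires two things.

* The same linear form `g` has to be used for all `i`. Being a Lefschetz element of `U_i` is a
  non-empty Zariski open condition on `g`, given by the non-vanishing of determinants, and `K` is
  infinite (`exists_common_isLefschetz`).
* The gradings of the `Ũ_i` need the same centre. If `U_i` lives exactly in the degrees
  `a_i, …, b_i`, then the centre of `Ũ_i` is `(a_i + b_i + f_i - 1) / 2`. Let `c` be the socle degree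
  of `A` and `φ` a functional on `A` that is non-zero on the socle and vanishes in the other degrees.
  As `A` is Gorenstein, `φ (x y)` is a nondegenerate form, and hence `φ (z ^ (f_i - 1) x y)` induces
  a nondegenerate form on `U_i`. It pairs degree `p` with degree `c - (f_i - 1) - p`, which gives
  `a_i + b_i + f_i - 1 = c` (`exists_dual_degree`).
-/

namespace CSM

/-! ### Representations of `sl₂` -/

section Sl2

variable {K V : Type*} [Field K] [AddCommGroup V] [Module K V]

/-- The endomorphisms `H, E, F` satisfy the commutation relations of `sl₂`. Unlike Mathlib's
`IsSl2Triple`, this allows `H = 0`, that is, the trivial representation. -/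
structure IsSl2 (H E F : Module.End K V) : Prop where
  ef : E * F - F * E = H
  he : H * E - E * H = 2 * E
  hf : H * F - F * H = -(2 * F)

namespace IsSl2

variable {H E F : Module.End K V}

/-- Interchanging raising and lowering operators. -/
theorem symm (h : IsSl2 H E F) : IsSl2 (-H) F E where
  ef := by rw [← h.ef]; abel
  he := by
    have := h.hf
    calc -H * F - F * -H = -(H * F - F * H) := by noncomm_ring
      _ = 2 * F := by rw [this, neg_neg]
  hf := by
    have := h.he
    calc -H * E - E * -H = -(H * E - E * H) := by noncomm_ring
      _ = -(2 * E) := by rw [this]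

theorem raise (h : IsSl2 H E F) {μ : K} {x : V} (hx : H x = μ • x) :
    H (E x) = (μ + 2) • E x := by
  have := congrArg (fun T : Module.End K V => T x) h.he
  simp only [LinearMap.sub_apply, Module.End.mul_apply, hx, map_smul] at this
  have h2 : (2 : Module.End K V) (E x) = (2 : K) • E x := by
    rw [two_smul, ← one_add_one_eq_two]; rfl
  rw [h2, sub_eq_iff_eq_add] at this
  rw [this, add_smul, add_comm]

theorem lower (h : IsSl2 H E F) {μ : K} {x : V} (hx : H x = μ • x) :
    H (F x) = (μ - 2) • F x := by
  have := h.symm.raise (μ := -μ) (x := x) (by simp [hx])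
  rw [LinearMap.neg_apply, neg_eq_iff_eq_neg, ← neg_smul] at this
  rw [this]; congr 1; ring

theorem raise_pow (h : IsSl2 H E F) {μ : K} {x : V} (hx : H x = μ • x) (n : ℕ) :
    H ((E ^ n) x) = (μ + 2 * n) • (E ^ n) x := by
  induction n with
  | zero => simp [hx]
  | succ n ih =>
    rw [pow_succ', Module.End.mul_apply, h.raise ih]
    congr 1; push_cast; ring

theorem lower_raise_pow (h : IsSl2 H E F) {μ : K} {x : V} (hx : H x = μ • x) (n : ℕ) :
    F ((E ^ (n + 1)) x) = (E ^ (n + 1)) (F x) - ((n + 1) * (μ + n)) • (E ^ n) x := by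
  have key : ∀ y, F (E y) = E (F y) - H y := fun y => by rw [← h.ef]; simp
  have step : ∀ m y, E ((E ^ m) y) = (E ^ (m + 1)) y := fun m y => by rw [pow_succ']; rfl
  induction n with
  | zero => simp [key, hx]
  | succ n ih =>
    rw [← step (n + 1) x, key, ih, h.raise_pow hx, map_sub, map_smul, step, step, sub_sub,
      ← add_smul]
    congr 2; push_cast; ring

/-- `E ^ k` is injective on the space of weight `-k`. On a vector `x` of weight `-k` the operators
`E ^ (k + 1)` and `F` commute, so `E ^ k x = 0` forces `E ^ (k + 2) (F x) = 0`; by descending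
induction on `k` this gives `F x = 0`, and a lowest weight vector of weight `-k` generates a string
of length `k + 1`. -/
theorem pow_injective [CharZero K] [FiniteDimensional K V] (h : IsSl2 H E F) (k : ℕ) (x : V)
    (hx : H x = (-k : K) • x) (hk : (E ^ k) x = 0) : x = 0 := by
  obtain ⟨N, hN⟩ : ∃ N : ℕ, ∀ k : ℕ, N ≤ k → ∀ x : V, H x = (-k : K) • x → x = 0 := by
    have hfin : {k : ℕ | H.HasEigenvalue (-k : K)}.Finite :=
      (Module.End.finite_hasEigenvalue H).preimage fun a _ b _ hab => by simpa using hab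
    obtain ⟨N, hN⟩ := hfin.bddAbove
    refine ⟨N + 1, fun k hk x hx => ?_⟩
    by_contra h0
    have := hN (show k ∈ {k : ℕ | H.HasEigenvalue (-k : K)} from
      Module.End.hasEigenvalue_of_hasEigenvector ⟨Module.End.mem_eigenspace_iff.2 hx, h0⟩)
    omega
  obtain ⟨d, hd⟩ : ∃ d, N ≤ k + 2 * d := ⟨N, by omega⟩
  induction d generalizing k x with
  | zero => exact hN k (by omega) x hx
  | succ d ih =>
    have hFx : F x = 0 := by
      refine ih (k + 2) (F x) ?_ ?_ (by omega)
      · rw [h.lower hx]; congr 1; push_cast; ring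
      · have := h.lower_raise_pow hx k
        rw [neg_add_cancel, mul_zero, zero_smul, sub_zero, pow_succ', Module.End.mul_apply, hk,
          map_zero, map_zero] at this
        rw [show k + 2 = (k + 1) + 1 from rfl, pow_succ' E (k + 1), Module.End.mul_apply,
          pow_succ', Module.End.mul_apply] at *
        rw [← this, map_zero]
    have descend : ∀ n ≤ k, (E ^ n) x = 0 → x = 0 := by
      intro n
      induction n with
      | zero => intro _ h0; simpa using h0
      | succ n ihn =>
        intro hn h0
        refine ihn (by omega) ?_
        have := h.lower_raise_pow hx n
        rw [h0, hFx, map_zero, map_zero, zero_sub, eq_comm, neg_eq_zero] at this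
        refine (smul_eq_zero.1 this).resolve_left (mul_ne_zero (Nat.cast_add_one_ne_zero n) ?_)
        rw [neg_add_eq_sub, sub_ne_zero]
        exact_mod_cast (show n ≠ k by omega)
    exact descend k le_rfl hk

end IsSl2

/-- An injective linear map between submodules of the same finite dimension is bijective. -/
theorem bijOn_of_finrank_eq [FiniteDimensional K V] (T : V →ₗ[K] V) (P Q : Submodule K V)
    (hT : ∀ x ∈ P, T x ∈ Q) (hinj : ∀ x ∈ P, T x = 0 → x = 0)
    (hPQ : Module.finrank K P = Module.finrank K Q) : Set.BijOn T P Q := by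
  have hi : Function.Injective (T.restrict hT) := by
    rw [injective_iff_map_eq_zero]
    intro x hx
    exact Subtype.ext (hinj x x.2 (congrArg Subtype.val hx))
  have hs := (LinearMap.injective_iff_surjective_of_finrank_eq_finrank hPQ).1 hi
  refine ⟨hT, fun x hx y hy hxy => ?_, fun y hy => ?_⟩
  · exact congrArg Subtype.val (@hi ⟨x, hx⟩ ⟨y, hy⟩ (Subtype.ext hxy))
  · obtain ⟨x, hx⟩ := hs ⟨y, hy⟩
    exact ⟨x, x.2, congrArg Subtype.val hx⟩

theorem finrank_le_of_injOn [FiniteDimensional K V] (T : V →ₗ[K] V) (P Q : Submodule K V)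
    (hT : ∀ x ∈ P, T x ∈ Q) (hinj : ∀ x ∈ P, T x = 0 → x = 0) :
    Module.finrank K P ≤ Module.finrank K Q := by
  refine LinearMap.finrank_le_finrank_of_injective (f := T.restrict hT) ?_
  rw [injective_iff_map_eq_zero]
  intro x hx
  exact Subtype.ext (hinj x x.2 (congrArg Subtype.val hx))

theorem IsSl2.bijOn [CharZero K] [FiniteDimensional K V] {H E F : Module.End K V}
    (h : IsSl2 H E F) (k : ℕ) :
    Set.BijOn (E ^ k) (H.eigenspace (-k : K) : Set V) (H.eigenspace (k : K)) := by
  have maps : ∀ {H E F : Module.End K V}, IsSl2 H E F → ∀ {x}, H x = (-k : K) • x →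
      H ((E ^ k) x) = (k : K) • (E ^ k) x := by
    intro H E F h x hx
    rw [h.raise_pow hx]; congr 1; ring
  have hE : ∀ x ∈ H.eigenspace (-k : K), (E ^ k) x ∈ H.eigenspace (k : K) := fun x hx =>
    Module.End.mem_eigenspace_iff.2 (maps h (Module.End.mem_eigenspace_iff.1 hx))
  have hE0 : ∀ x ∈ H.eigenspace (-k : K), (E ^ k) x = 0 → x = 0 := fun x hx =>
    h.pow_injective k x (Module.End.mem_eigenspace_iff.1 hx)
  have neg : ∀ {x}, x ∈ H.eigenspace (k : K) → (-H) x = (-k : K) • x := fun {x} hx => by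
    rw [LinearMap.neg_apply, Module.End.mem_eigenspace_iff.1 hx, neg_smul]
  refine bijOn_of_finrank_eq _ _ _ hE hE0 (le_antisymm (finrank_le_of_injOn _ _ _ hE hE0) ?_)
  refine finrank_le_of_injOn (F ^ k) _ _ (fun x hx => ?_) fun x hx =>
    h.symm.pow_injective k x (neg hx)
  rw [Module.End.mem_eigenspace_iff, ← neg_inj, ← LinearMap.neg_apply, maps h.symm (neg hx),
    neg_smul, neg_neg]

end Sl2

/-! ### The lowering operator of a Lefschetz element -/

section Lowering

variable {K V : Type*} [Field K] [AddCommGroup V] [Module K V]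

/-- The endomorphism `E` of degree one is a Lefschetz operator for the family `𝒱` with centre
`c / 2`: all maps `E ^ k : 𝒱 n → 𝒱 (n + k)` with `2 n + k = c` are bijective, and `𝒱` vanishes
outside the degrees `0, …, c`. -/
structure IsLefschetz (𝒱 : ℕ → Submodule K V) (c : ℕ) (E : Module.End K V) : Prop where
  map_mem : ∀ n, ∀ x ∈ 𝒱 n, E x ∈ 𝒱 (n + 1)
  le_of_ne_bot : ∀ n, 𝒱 n ≠ ⊥ → n ≤ c
  bijOn : ∀ n k, 2 * n + k = c → Set.BijOn (E ^ k) (𝒱 n : Set V) (𝒱 (n + k))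

theorem IsLefschetz.pow_mem {𝒱 : ℕ → Submodule K V} {c : ℕ} {E : Module.End K V}
    (h : IsLefschetz 𝒱 c E) {n : ℕ} (j : ℕ) {x : V} (hx : x ∈ 𝒱 n) : (E ^ j) x ∈ 𝒱 (n + j) := by
  induction j with
  | zero => simpa
  | succ j ih => rw [pow_succ', Module.End.mul_apply]; exact h.map_mem _ _ ih

/-- The part of `𝒱` left over after splitting off the strings `⨁ⱼ E ^ j 𝒱 a` that start in the
lowest degree `a` and end in degree `b`. -/
def stringComplement (𝒱 : ℕ → Submodule K V) (E : Module.End K V) (b n : ℕ) : Submodule K V :=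
  𝒱 n ⊓ LinearMap.ker (E ^ (b - n))

theorem mem_stringComplement {𝒱 : ℕ → Submodule K V} {E : Module.End K V} {b n : ℕ} {x : V} :
    x ∈ stringComplement 𝒱 E b n ↔ x ∈ 𝒱 n ∧ (E ^ (b - n)) x = 0 := Iff.rfl

theorem stringComplement_isLefschetz {𝒱 : ℕ → Submodule K V} {c : ℕ} {E : Module.End K V}
    (h : IsLefschetz 𝒱 c E) {a : ℕ} (ha : ∀ n, 𝒱 n ≠ ⊥ → a ≤ n ∧ n + a ≤ c) :
    IsLefschetz (stringComplement 𝒱 E (c - a)) c E where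
  map_mem n x hx := by
    rw [mem_stringComplement] at hx ⊢
    refine ⟨h.map_mem n x hx.1, ?_⟩
    by_cases hn : n < c - a
    · rw [← Module.End.mul_apply, ← pow_succ, show c - a - (n + 1) + 1 = c - a - n by omega]
      exact hx.2
    · rw [show c - a - n = 0 by omega, pow_zero, Module.End.one_apply] at hx
      rw [hx.2, map_zero, map_zero]
  le_of_ne_bot n hn := h.le_of_ne_bot n fun h0 => hn (by simp [stringComplement, h0])
  bijOn n k hnk := by
    have hb := h.bijOn n k hnk
    by_cases hn : 𝒱 n = ⊥
    · have hn' : 𝒱 (n + k) = ⊥ := by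
        rw [eq_bot_iff]
        intro y hy
        obtain ⟨x, hx, rfl⟩ := hb.surjOn hy
        rw [hn] at hx
        simp [(Submodule.mem_bot K).1 hx]
      have h1 : stringComplement 𝒱 E (c - a) n = ⊥ := by simp [stringComplement, hn]
      have h2 : stringComplement 𝒱 E (c - a) (n + k) = ⊥ := by simp [stringComplement, hn']
      rw [h1, h2]
      simp
    · have hna := ha n hn
      have hpow : ∀ x, (E ^ (c - a - (n + k))) ((E ^ k) x) = (E ^ (c - a - n)) x := fun x => by
        rw [← Module.End.mul_apply, ← pow_add]; congr 2; omega
      refine ⟨fun x hx => ?_, hb.injOn.mono fun x hx => hx.1, fun y hy => ?_⟩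
      · exact mem_stringComplement.2 ⟨hb.mapsTo hx.1, by rw [hpow]; exact hx.2⟩
      · obtain ⟨x, hx, rfl⟩ := hb.surjOn hy.1
        exact ⟨x, mem_stringComplement.2 ⟨hx, by rw [← hpow]; exact hy.2⟩, rfl⟩

theorem stringComplement_ne_bot {𝒱 : ℕ → Submodule K V} {c : ℕ} {E : Module.End K V}
    (h : IsLefschetz 𝒱 c E) {a : ℕ} (ha : ∀ n, 𝒱 n ≠ ⊥ → a ≤ n ∧ n + a ≤ c) (n : ℕ)
    (hn : stringComplement 𝒱 E (c - a) n ≠ ⊥) : a + 1 ≤ n ∧ n + (a + 1) ≤ c := by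
  have hna := ha n fun h0 => hn (by simp [stringComplement, h0])
  obtain ⟨x, hx, hx0⟩ := Submodule.exists_mem_ne_zero_of_ne_bot hn
  rw [mem_stringComplement] at hx
  constructor
  · by_contra hlt
    obtain rfl : n = a := by omega
    have hb := h.bijOn n (c - n - n) (by omega)
    exact hx0 (hb.injOn hx.1 (zero_mem _) (by rw [hx.2, map_zero]))
  · by_contra hlt
    rw [show c - a - n = 0 by omega] at hx
    exact hx0 hx.2

/-- A Lefschetz operator has a partner lowering operator, given here by its restrictions `F n` to
the pieces `𝒱 n`. With `a` the lowest degree and `b = c - a`, every `x` in degree `a + j` is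
`E ^ j u + x'` for unique `u` in degree `a` and `x'` in the string complement; `F` is
`E ^ j u ↦ j (b - a - j + 1) E ^ (j - 1) u` on the first part and given by induction on the
second. -/
theorem exists_graded_lowering (c : ℕ) (E : Module.End K V) (d : ℕ) :
    ∀ (a : ℕ), c + 1 ≤ 2 * a + d → ∀ 𝒱 : ℕ → Submodule K V, IsLefschetz 𝒱 c E →
    (∀ n, 𝒱 n ≠ ⊥ → a ≤ n ∧ n + a ≤ c) →
    ∃ F : ℕ → Module.End K V, (∀ n, ∀ x ∈ 𝒱 (n + 1), F (n + 1) x ∈ 𝒱 n) ∧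
      (∀ x ∈ 𝒱 0, F 0 x = 0) ∧
      ∀ n, ∀ x ∈ 𝒱 n, E (F n x) - F (n + 1) (E x) = (2 * n - c : K) • x := by
  have trivial_case : ∀ 𝒱 : ℕ → Submodule K V, (∀ n, 𝒱 n = ⊥) →
      ∃ F : ℕ → Module.End K V, (∀ n, ∀ x ∈ 𝒱 (n + 1), F (n + 1) x ∈ 𝒱 n) ∧
      (∀ x ∈ 𝒱 0, F 0 x = 0) ∧
      ∀ n, ∀ x ∈ 𝒱 n, E (F n x) - F (n + 1) (E x) = (2 * n - c : K) • x := by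
    intro 𝒱 h0
    refine ⟨0, fun n x _ => by simp, fun x _ => by simp, fun n x hx => ?_⟩
    rw [h0, Submodule.mem_bot] at hx
    simp [hx]
  induction d with
  | zero =>
    intro a hd 𝒱 _ ha
    refine trivial_case 𝒱 fun n => ?_
    by_contra hn
    have := ha n hn
    omega
  | succ d ih =>
    intro a hd 𝒱 h ha
    by_cases hac : c < 2 * a
    · refine trivial_case 𝒱 fun n => ?_
      by_contra hn
      have := ha n hn
      omega
    obtain ⟨F', hF', hF0', hEF'⟩ := ih (a + 1) (by omega) _ (stringComplement_isLefschetz h ha)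
      (stringComplement_ne_bot h ha)
    have hb := h.bijOn a (c - 2 * a) (by omega)
    obtain ⟨L, hL⟩ := LinearMap.exists_leftInverse_of_injective
      ((E ^ (c - 2 * a)).comp (𝒱 a).subtype) (LinearMap.ker_eq_bot.2 fun x y hxy =>
        Subtype.ext (hb.injOn x.2 y.2 hxy))
    have hL' : ∀ u (hu : u ∈ 𝒱 a), (L ((E ^ (c - 2 * a)) u) : V) = u := fun u hu =>
      congrArg Subtype.val (LinearMap.congr_fun hL ⟨u, hu⟩)
    -- The component `u` of an element in degree `n`.
    let π : ℕ → Module.End K V := fun n => (𝒱 a).subtype ∘ₗ L ∘ₗ (E ^ (c - a - n))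
    have π_mem : ∀ n x, π n x ∈ 𝒱 a := fun n x => (L ((E ^ (c - a - n)) x)).2
    have hπ : ∀ j x, x ∈ 𝒱 (a + j) → x - (E ^ j) (π (a + j) x) ∈
        stringComplement 𝒱 E (c - a) (a + j) := by
      intro j x hx
      by_cases hbot : 𝒱 (a + j) = ⊥
      · rw [hbot, Submodule.mem_bot] at hx
        simp [hx]
      have hj := ha _ hbot
      refine mem_stringComplement.2 ⟨sub_mem hx (h.pow_mem j (π_mem _ x)), ?_⟩
      rw [map_sub, sub_eq_zero, ← Module.End.mul_apply, ← pow_add,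
        show c - a - (a + j) + j = c - 2 * a by omega]
      have hmem : (E ^ (c - a - (a + j))) x ∈ 𝒱 (a + (c - 2 * a)) := by
        have := h.pow_mem (c - a - (a + j)) hx
        rwa [show a + j + (c - a - (a + j)) = a + (c - 2 * a) by omega] at this
      obtain ⟨u, hu, hux⟩ := hb.surjOn hmem
      change _ = (E ^ (c - 2 * a)) (L ((E ^ (c - a - (a + j))) x) : V)
      rw [← hux, hL' u hu]
    refine ⟨fun n => ((n - a : ℕ) * (c - a - n + 1 : ℕ) : K) • ((E ^ (n - a - 1)) * π n) +
      F' n * (1 - E ^ (n - a) * π n), fun n x hx => ?_, fun x hx => ?_, fun n x hx => ?_⟩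
    · by_cases hx0 : x = 0
      · simp [hx0]
      obtain ⟨j, hj⟩ := Nat.exists_eq_add_of_le
        (ha _ fun h0 => hx0 (by rwa [h0, Submodule.mem_bot] at hx)).1
      have hpi := hπ j x (hj ▸ hx)
      rw [← hj] at hpi
      simp only [hj, Nat.add_sub_cancel_left, LinearMap.add_apply, LinearMap.smul_apply,
        Module.End.mul_apply, LinearMap.sub_apply, Module.End.one_apply]
      rw [← hj]
      refine add_mem ?_ (hF' n _ hpi).1
      cases j with
      | zero => simp
      | succ j =>
        have hna : n = a + j := by omega
        refine Submodule.smul_mem _ _ ?_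
        rw [Nat.add_sub_cancel, hna]
        exact h.pow_mem j (π_mem _ x)
    · by_cases hx0 : x = 0
      · simp [hx0]
      obtain rfl : a = 0 := by
        have := (ha 0 fun h0 => hx0 (by rwa [h0, Submodule.mem_bot] at hx)).1
        omega
      have hpi := hF0' _ (hπ 0 x hx)
      simpa using hpi
    · by_cases hx0 : x = 0
      · simp [hx0]
      have hna := ha n fun h0 => hx0 (by rwa [h0, Submodule.mem_bot] at hx)
      obtain ⟨j, rfl⟩ := Nat.exists_eq_add_of_le hna.1
      have hpi := hπ j x hx
      obtain ⟨r, hr⟩ := Nat.exists_eq_add_of_le hna.2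
      have hrec := hEF' _ _ hpi
      have e1 : c - a - (a + j) = r := by omega
      have e2 : a + j + 1 - a = j + 1 := by omega
      simp only [Nat.add_sub_cancel_left, LinearMap.add_apply, LinearMap.smul_apply,
        Module.End.mul_apply, LinearMap.sub_apply, Module.End.one_apply, e1, e2,
        Nat.add_sub_cancel]
      set u := π (a + j) x with hu
      have hE : (j : K) • E ((E ^ (j - 1)) u) = (j : K) • (E ^ j) u := by
        cases j with
        | zero => simp
        | succ j => rw [pow_succ' E j]; rfl
      have hc : (c : K) = 2 * a + j + r := by
        rw [hr]; push_cast; ring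
      cases r with
      | zero =>
        -- In the top degree `b` both `E x` and the remainder `x - E ^ j u` vanish.
        have hEx : E x = 0 := by
          have hbot : 𝒱 (a + j + 1) = ⊥ := by
            by_contra h0
            have := ha _ h0
            omega
          have := h.map_mem _ _ hx
          rwa [hbot, Submodule.mem_bot] at this
        have hv : x - (E ^ j) u = 0 := by
          have := (mem_stringComplement.1 hpi).2
          rwa [e1, pow_zero, Module.End.one_apply] at this
        rw [hv, hEx]
        simp only [map_zero, add_zero, smul_zero, sub_zero, map_smul]
        rw [mul_comm, mul_smul, hE, ← sub_eq_zero.1 hv, hc, ← mul_smul]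
        congr 1
        push_cast
        ring
      | succ r =>
        have hu' : π (a + j + 1) (E x) = u := by
          change (L ((E ^ (c - a - (a + j + 1))) (E x)) : V) = L ((E ^ (c - a - (a + j))) x)
          rw [← Module.End.mul_apply, ← pow_succ]
          congr 4
          omega
        have hE' : E x - (E ^ (j + 1)) u = E (x - (E ^ j) u) := by
          rw [map_sub, pow_succ']; rfl
        have e3 : c - a - (a + j + 1) = r := by omega
        rw [hu', hE', e3, map_add, map_smul]
        rw [hc] at hrec ⊢
        push_cast at hrec hE ⊢
        linear_combination (norm := module) (r + 2 : K) • hE + hrec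

end Lowering

/-! ### Graded representations of `sl₂`, their tensor products and direct sums -/

section Triple

variable {K V : Type*} [Field K] [AddCommGroup V] [Module K V]

/-- The endomorphisms `H, E, F` satisfy the `sl₂` relations, and `V = ⨁ₙ 𝒱 n`, `0 ≤ n ≤ c`, is the
decomposition of `V` into weight spaces, `𝒱 n` having weight `2 n - c`. -/
structure IsGradedSl2 (𝒱 : ℕ → Submodule K V) (c : ℕ) (H E F : Module.End K V) : Prop
    extends IsSl2 H E F where
  mem_iff : ∀ n x, x ∈ 𝒱 n ↔ H x = (2 * n - c : K) • x
  iSup_eq_top : ⨆ n, 𝒱 n = ⊤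
  le_of_ne_bot : ∀ n, 𝒱 n ≠ ⊥ → n ≤ c

/-- If `V` is spanned by pieces `𝒱 n` on which `H` acts by distinct scalars `μ n`, then the pieces
are the full eigenspaces. -/
theorem mem_of_eigen (𝒱 : ℕ → Submodule K V) (μ : ℕ → K)
    (hμ : Function.Injective μ) (H : Module.End K V) (hH : ∀ n, ∀ x ∈ 𝒱 n, H x = μ n • x)
    (htop : ⨆ n, 𝒱 n = ⊤) {n : ℕ} {x : V} (hx : H x = μ n • x) : x ∈ 𝒱 n := by
  have hle : ∀ m, 𝒱 m ≤ H.eigenspace (μ m) := fun m y hy =>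
    Module.End.mem_eigenspace_iff.2 (hH m y hy)
  have hind : iSupIndep fun m => H.eigenspace (μ m) := H.eigenspaces_iSupIndep.comp hμ
  have htop' : 𝒱 n ⊔ ⨆ m, ⨆ _ : m ≠ n, H.eigenspace (μ m) = ⊤ := by
    rw [eq_top_iff, ← htop]
    refine iSup_le fun m => ?_
    by_cases hm : m = n
    · subst hm; exact le_sup_left
    · exact (hle m).trans (le_sup_of_le_right (le_iSup₂_of_le m hm le_rfl))
  obtain ⟨y, hy, t, ht, rfl⟩ := Submodule.mem_sup.1 (htop' ▸ Submodule.mem_top : x ∈ _)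
  have ht0 : t = 0 := by
    refine (Submodule.mem_bot K).1 ((hind n).le_bot ⟨?_, ht⟩)
    have := sub_mem (Module.End.mem_eigenspace_iff.2 hx) (hle n hy)
    rwa [add_sub_cancel_left] at this
  rwa [ht0, add_zero]

theorem weight_injective [CharZero K] (c : ℕ) :
    Function.Injective fun n : ℕ => (2 * n - c : K) := fun a b h => by
  simpa using h

theorem end_ext_of_iSup {𝒱 : ℕ → Submodule K V} (htop : ⨆ n, 𝒱 n = ⊤) {S T : Module.End K V}
    (h : ∀ n, ∀ x ∈ 𝒱 n, S x = T x) : S = T := by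
  have : (⊤ : Submodule K V) ≤ LinearMap.eqLocus S T := htop ▸ iSup_le fun n x hx => h n x hx
  exact LinearMap.ext fun x => this Submodule.mem_top

theorem exists_end_of_isInternal {𝒱 : ℕ → Submodule K V} (h : DirectSum.IsInternal 𝒱)
    (φ : ℕ → Module.End K V) : ∃ Φ : Module.End K V, ∀ n, ∀ x ∈ 𝒱 n, Φ x = φ n x := by
  let e := LinearEquiv.ofBijective (DirectSum.coeLinearMap 𝒱) h
  refine ⟨(DirectSum.toModule K ℕ V fun n => φ n ∘ₗ (𝒱 n).subtype) ∘ₗ e.symm.toLinearMap,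
    fun n x hx => ?_⟩
  have : e.symm x = DirectSum.lof K ℕ (fun n => 𝒱 n) n ⟨x, hx⟩ := by
    rw [LinearEquiv.symm_apply_eq]
    exact (DirectSum.coeLinearMap_lof 𝒱 n ⟨x, hx⟩).symm
  simp [this]

/-- A Lefschetz operator is the raising operator of a graded representation of `sl₂`. -/
theorem IsLefschetz.exists_isGradedSl2 [CharZero K] {𝒱 : ℕ → Submodule K V} {c : ℕ}
    {E : Module.End K V} (hV : DirectSum.IsInternal 𝒱) (h : IsLefschetz 𝒱 c E) :
    ∃ H F, IsGradedSl2 𝒱 c H E F := by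
  have htop := hV.submodule_iSup_eq_top
  obtain ⟨φ, hφ, hφ0, hEF⟩ := exists_graded_lowering c E (c + 1) 0 (by omega) 𝒱 h
    fun n hn => ⟨Nat.zero_le n, h.le_of_ne_bot n hn⟩
  obtain ⟨F, hF⟩ := exists_end_of_isInternal hV φ
  obtain ⟨H, hH⟩ := exists_end_of_isInternal hV fun n => (2 * n - c : K) • 1
  replace hH : ∀ n, ∀ x ∈ 𝒱 n, H x = (2 * n - c : K) • x := fun n x hx => by simp [hH n x hx]
  have h2 : ∀ (T : Module.End K V) x, (2 * T) x = (2 : K) • T x := fun T x => by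
    rw [two_mul, two_smul]; rfl
  refine ⟨H, F, ⟨?_, ?_, ?_⟩, fun n x => ⟨hH n x, fun hx =>
    mem_of_eigen 𝒱 _ (weight_injective c) H hH htop hx⟩, htop, h.le_of_ne_bot⟩
  · refine end_ext_of_iSup htop fun n x hx => ?_
    simp [hF n x hx, hF _ _ (h.map_mem n x hx), hEF n x hx, hH n x hx]
  · refine end_ext_of_iSup htop fun n x hx => ?_
    simp only [LinearMap.sub_apply, Module.End.mul_apply, hH _ _ (h.map_mem n x hx), hH n x hx,
      map_smul, h2]
    push_cast
    module
  · refine end_ext_of_iSup htop fun n x hx => ?_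
    simp only [LinearMap.sub_apply, LinearMap.neg_apply, Module.End.mul_apply, hH n x hx,
      map_smul, h2, hF n x hx]
    cases n with
    | zero => simp [hφ0 x hx]
    | succ n =>
      rw [hH _ _ (hφ n x hx)]
      push_cast
      module

theorem IsGradedSl2.exists_ne_bot [Nontrivial V] {𝒱 : ℕ → Submodule K V} {c : ℕ}
    {H E F : Module.End K V} (h : IsGradedSl2 𝒱 c H E F) : ∃ n, 𝒱 n ≠ ⊥ := by
  by_contra hcon
  push Not at hcon
  exact bot_ne_top ((iSup_eq_bot.2 hcon).symm.trans h.iSup_eq_top)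

theorem IsGradedSl2.isLefschetz [CharZero K] [FiniteDimensional K V] {𝒱 : ℕ → Submodule K V}
    {c : ℕ} {H E F : Module.End K V} (h : IsGradedSl2 𝒱 c H E F) : IsLefschetz 𝒱 c E where
  map_mem n x hx := by
    rw [h.mem_iff] at hx ⊢
    rw [h.raise hx]
    congr 1; push_cast; ring
  le_of_ne_bot := h.le_of_ne_bot
  bijOn n k hnk := by
    have h1 : 𝒱 n = H.eigenspace (-k : K) := by
      ext x
      rw [h.mem_iff, Module.End.mem_eigenspace_iff, ← hnk]
      push_cast; ring_nf
    have h2 : 𝒱 (n + k) = H.eigenspace (k : K) := by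
      ext x
      rw [h.mem_iff, Module.End.mem_eigenspace_iff, ← hnk]
      push_cast; ring_nf
    rw [h1, h2]
    exact h.toIsSl2.bijOn k

end Triple

section TensorProduct

variable {K M N : Type*} [Field K] [AddCommGroup M] [Module K M] [AddCommGroup N] [Module K N]

theorem iSup_tensorGrading {𝒱 : ℕ → Submodule K M} {𝒲 : ℕ → Submodule K N}
    (hV : ⨆ n, 𝒱 n = ⊤) (hW : ⨆ n, 𝒲 n = ⊤) : ⨆ n, tensorGrading 𝒱 𝒲 n = ⊤ := by
  rw [eq_top_iff, ← TensorProduct.map₂_mk_top_top_eq_top, ← hV, ← hW, Submodule.map₂_iSup_left]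
  refine iSup_le fun p => ?_
  rw [Submodule.map₂_iSup_right]
  refine iSup_le fun q => le_iSup_of_le (p + q) ?_
  exact le_iSup₂_of_le (f := fun (r : ℕ × ℕ) _ => Submodule.map₂ (TensorProduct.mk K M N) (𝒱 r.1)
    (𝒲 r.2)) (p, q) (Finset.HasAntidiagonal.mem_antidiagonal.2 rfl) le_rfl

/-- The operator `S ⊗ 1 + 1 ⊗ T`. -/
def tensorSum (S : Module.End K M) (T : Module.End K N) : Module.End K (M ⊗[K] N) :=
  S.rTensor N + T.lTensor M

theorem tensorSum_tmul (S : Module.End K M) (T : Module.End K N) (x : M) (y : N) :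
    tensorSum S T (x ⊗ₜ y) = S x ⊗ₜ y + x ⊗ₜ T y := by
  simp [tensorSum]

theorem tensorSum_commutator (S S' : Module.End K M) (T T' : Module.End K N) :
    tensorSum S T * tensorSum S' T' - tensorSum S' T' * tensorSum S T =
      tensorSum (S * S' - S' * S) (T * T' - T' * T) := by
  ext x y
  simp [tensorSum_tmul, TensorProduct.sub_tmul, TensorProduct.tmul_sub]
  abel

theorem IsSl2.tensor {H E F : Module.End K M} {H' E' F' : Module.End K N} (h : IsSl2 H E F)
    (h' : IsSl2 H' E' F') : IsSl2 (tensorSum H H') (tensorSum E E') (tensorSum F F') where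
  ef := by rw [tensorSum_commutator, h.ef, h'.ef]
  he := by
    rw [tensorSum_commutator, h.he, h'.he]
    ext x y
    simp [tensorSum_tmul, two_mul, TensorProduct.add_tmul, TensorProduct.tmul_add]
    abel
  hf := by
    rw [tensorSum_commutator, h.hf, h'.hf]
    ext x y
    simp [tensorSum_tmul, two_mul, TensorProduct.add_tmul, TensorProduct.tmul_add,
      TensorProduct.neg_tmul, TensorProduct.tmul_neg]
    abel

theorem IsGradedSl2.tensor [CharZero K] {𝒱 : ℕ → Submodule K M} {𝒲 : ℕ → Submodule K N}
    {c c' : ℕ} {H E F : Module.End K M} {H' E' F' : Module.End K N} (h : IsGradedSl2 𝒱 c H E F)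
    (h' : IsGradedSl2 𝒲 c' H' E' F') :
    IsGradedSl2 (tensorGrading 𝒱 𝒲) (c + c') (tensorSum H H') (tensorSum E E')
      (tensorSum F F') := by
  have htop := iSup_tensorGrading h.iSup_eq_top h'.iSup_eq_top
  have hH : ∀ n, ∀ x ∈ tensorGrading 𝒱 𝒲 n,
      tensorSum H H' x = (2 * n - (c + c' : ℕ) : K) • x := by
    intro n
    suffices tensorGrading 𝒱 𝒲 n ≤ (tensorSum H H').eigenspace (2 * n - (c + c' : ℕ) : K) from
      fun x hx => Module.End.mem_eigenspace_iff.1 (this hx)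
    refine iSup₂_le fun p hp => Submodule.map₂_le.2 fun x hx y hy => ?_
    rw [Module.End.mem_eigenspace_iff, TensorProduct.mk_apply, tensorSum_tmul,
      (h.mem_iff _ _).1 hx, (h'.mem_iff _ _).1 hy, ← TensorProduct.smul_tmul',
      TensorProduct.tmul_smul, ← add_smul, ← Finset.HasAntidiagonal.mem_antidiagonal.1 hp]
    congr 1; push_cast; ring
  refine ⟨h.toIsSl2.tensor h'.toIsSl2, fun n x => ⟨hH n x, fun hx =>
    mem_of_eigen _ _ (weight_injective (c + c')) _ hH htop hx⟩, htop, fun n hn => ?_⟩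
  by_contra hlt
  refine hn (eq_bot_iff.2 (iSup₂_le fun p hp => ?_))
  rw [Finset.HasAntidiagonal.mem_antidiagonal] at hp
  have : 𝒱 p.1 = ⊥ ∨ 𝒲 p.2 = ⊥ := by
    by_contra hcon
    push Not at hcon
    have h1 := h.le_of_ne_bot _ hcon.1
    have h2 := h'.le_of_ne_bot _ hcon.2
    omega
  rcases this with h0 | h0 <;> simp [h0]

end TensorProduct

section DirectSum

variable {K ι : Type*} [Field K] {M : ι → Type*} [∀ i, AddCommGroup (M i)] [∀ i, Module K (M i)]

theorem mem_directSumGrading {𝒱 : ∀ i, ℕ → Submodule K (M i)} {n : ℕ} {x : ⨁ i, M i} :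
    x ∈ directSumGrading 𝒱 n ↔ ∀ i, x i ∈ 𝒱 i n := by
  simp only [directSumGrading, Submodule.mem_iInf, Submodule.mem_comap]
  rfl

theorem lof_mem_directSumGrading [DecidableEq ι] {𝒱 : ∀ i, ℕ → Submodule K (M i)} {n : ℕ} {i : ι}
    {x : M i} (hx : x ∈ 𝒱 i n) : DirectSum.lof K ι M i x ∈ directSumGrading 𝒱 n := by
  rw [mem_directSumGrading]
  intro j
  by_cases hj : i = j
  · subst hj; rwa [DirectSum.lof_apply]
  · rw [DirectSum.lof_eq_of, DirectSum.of_eq_of_ne _ _ _ (Ne.symm hj)]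
    exact zero_mem _

theorem IsGradedSl2.directSum {𝒱 : ∀ i, ℕ → Submodule K (M i)} {c : ℕ}
    {H E F : ∀ i, Module.End K (M i)} (h : ∀ i, IsGradedSl2 (𝒱 i) c (H i) (E i) (F i)) :
    IsGradedSl2 (directSumGrading 𝒱) c (DirectSum.lmap H) (DirectSum.lmap E)
      (DirectSum.lmap F) := by
  classical
  have key : ∀ {i} {S T : Module.End K (M i)}, S = T → ∀ x, S x = T x := fun h x => by rw [h]
  refine ⟨⟨?_, ?_, ?_⟩, fun n x => ?_, ?_, fun n hn => ?_⟩
  · refine LinearMap.ext fun x => DFinsupp.ext fun i => ?_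
    simpa using key (h i).ef (x i)
  · refine LinearMap.ext fun x => DFinsupp.ext fun i => ?_
    simpa [two_mul] using key (h i).he (x i)
  · refine LinearMap.ext fun x => DFinsupp.ext fun i => ?_
    have := key (h i).hf (x i)
    simp only [two_mul, LinearMap.sub_apply, LinearMap.neg_apply, LinearMap.add_apply,
      Module.End.mul_apply] at this ⊢
    exact this
  · rw [mem_directSumGrading]
    constructor
    · intro hx
      refine DFinsupp.ext fun i => ?_
      exact ((h i).mem_iff n (x i)).1 (hx i)
    · intro hx i
      exact ((h i).mem_iff n (x i)).2 (congrArg (fun y : ⨁ i, M i => y i) hx)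
  · refine eq_top_iff.2 fun x _ => ?_
    induction x using DirectSum.induction_on with
    | zero => exact zero_mem _
    | add x y hx hy => exact add_mem (hx trivial) (hy trivial)
    | of i x =>
      suffices (⊤ : Submodule K (M i)) ≤
          (⨆ n, directSumGrading 𝒱 n).comap (DirectSum.lof K ι M i) from this Submodule.mem_top
      rw [← (h i).iSup_eq_top]
      exact iSup_le fun n x hx => Submodule.mem_iSup_of_mem n (lof_mem_directSumGrading hx)
  · obtain ⟨x, hx, hx0⟩ := Submodule.exists_mem_ne_zero_of_ne_bot hn
    rw [mem_directSumGrading] at hx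
    obtain ⟨i, hi⟩ : ∃ i, x i ≠ 0 := by
      by_contra hcon
      push Not at hcon
      exact hx0 (DFinsupp.ext hcon)
    exact (h i).le_of_ne_bot n fun h0 => hi (by simpa [h0] using hx i)

end DirectSum

/-! ### Gradings of quotients -/

section Quotient

variable {K V W : Type*} [Field K] [AddCommGroup V] [Module K V] [AddCommGroup W] [Module K W]

/-- The image of a graded space under a surjection with homogeneous kernel is graded. The grading
of the source is given by its projections `π n`. -/
theorem isInternal_map (p : W →ₗ[K] V) (hp : Function.Surjective p) (𝒲 : ℕ → Submodule K W)
    (π : ℕ → Module.End K W) (hπ : ∀ n, ∀ w ∈ 𝒲 n, π n w = w)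
    (hπ' : ∀ m n, m ≠ n → ∀ w ∈ 𝒲 m, π n w = 0) (hmem : ∀ n w, π n w ∈ 𝒲 n)
    (hsum : ∀ w, ∃ s : Finset ℕ, ∑ n ∈ s, π n w = w) (hker : ∀ n w, p w = 0 → p (π n w) = 0) :
    DirectSum.IsInternal fun n => (𝒲 n).map p := by
  obtain ⟨σ, hσ⟩ := p.exists_rightInverse_of_surjective (LinearMap.range_eq_top.2 hp)
  -- The projections descend to the image.
  have hϖ : ∀ n w, (p ∘ₗ π n ∘ₗ σ) (p w) = p (π n w) := fun n w => by
    have h0 : p (σ (p w) - w) = 0 := by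
      rw [map_sub, sub_eq_zero]
      exact LinearMap.congr_fun hσ (p w)
    have := hker n _ h0
    rwa [map_sub, map_sub, sub_eq_zero] at this
  refine DirectSum.isInternal_submodule_of_iSupIndep_of_iSup_eq_top (fun n => ?_) ?_
  · rw [Submodule.disjoint_def]
    intro x hx hx'
    have h1 : (p ∘ₗ π n ∘ₗ σ) x = x := by
      obtain ⟨w, hw, rfl⟩ := hx
      rw [hϖ, hπ n w hw]
    have h2 : (⨆ m, ⨆ _ : m ≠ n, (𝒲 m).map p) ≤ LinearMap.ker (p ∘ₗ π n ∘ₗ σ) := by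
      refine iSup₂_le fun m hm => ?_
      rintro _ ⟨w, hw, rfl⟩
      rw [LinearMap.mem_ker, hϖ, hπ' m n hm w hw, map_zero]
    rw [← h1]
    exact h2 hx'
  · refine eq_top_iff.2 fun x _ => ?_
    obtain ⟨w, rfl⟩ := hp x
    obtain ⟨s, hs⟩ := hsum w
    rw [← hs, map_sum]
    exact sum_mem fun n _ => Submodule.mem_iSup_of_mem n ⟨_, hmem n w, rfl⟩

end Quotient

section CentralSimple

variable {K A : Type*} [Field K] [CommRing A] [Algebra K A] (𝒜 : ℕ → Submodule K A)
  [GradedAlgebra 𝒜]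

theorem isHomogeneous_colon_pow {z : A} (hz : z ∈ 𝒜 1) (k : ℕ) :
    ((⊥ : Ideal A).colon {z ^ k}).IsHomogeneous 𝒜 := by
  intro n x hx
  rw [Submodule.mem_colon_singleton, Submodule.mem_bot, smul_eq_mul] at hx ⊢
  have hzk : z ^ k ∈ 𝒜 (k • 1) := SetLike.pow_mem_graded k hz
  rw [← DirectSum.coe_decompose_mul_add_of_right_mem 𝒜 hzk, hx, DirectSum.decompose_zero]
  rfl

theorem isHomogeneous_annPowAdd {z : A} (hz : z ∈ 𝒜 1) (k : ℕ) :
    (annPowAdd z k).IsHomogeneous 𝒜 :=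
  (isHomogeneous_colon_pow 𝒜 hz k).sup
    (Ideal.homogeneous_span 𝒜 _ fun x hx => ⟨1, by rwa [Set.mem_singleton_iff.1 hx]⟩)

/-- The projection of a homogeneous ideal to its degree `n` piece. -/
def idealProj {I : Ideal A} (hI : I.IsHomogeneous 𝒜) (n : ℕ) : Module.End K I where
  toFun x := ⟨GradedAlgebra.proj 𝒜 n x, hI n x.2⟩
  map_add' x y := Subtype.ext (map_add (GradedAlgebra.proj 𝒜 n) (x : A) y)
  map_smul' r x := Subtype.ext (map_smul (GradedAlgebra.proj 𝒜 n) r (x : A))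

theorem isInternal_ideal_quotient {I J : Ideal A} (hI : I.IsHomogeneous 𝒜)
    (hJ : J.IsHomogeneous 𝒜) :
    DirectSum.IsInternal fun n => ((𝒜 n).comap (I.subtype.restrictScalars K)).map
      ((J.submoduleOf I).mkQ.restrictScalars K) := by
  classical
  have hp : Function.Surjective ((J.submoduleOf I).mkQ.restrictScalars K) := by
    rw [LinearMap.coe_restrictScalars]
    exact Submodule.mkQ_surjective (J.submoduleOf I)
  refine isInternal_map ((J.submoduleOf I).mkQ.restrictScalars K) hp
    (fun n => (𝒜 n).comap (I.subtype.restrictScalars K)) (idealProj 𝒜 hI)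
    (fun n w hw => ?_) (fun m n hmn w hw => ?_) (fun n w => ?_) (fun w => ?_) (fun n w hw => ?_)
  · exact Subtype.ext (DirectSum.decompose_of_mem_same 𝒜 hw)
  · exact Subtype.ext (DirectSum.decompose_of_mem_ne 𝒜 hw hmn)
  · exact (DirectSum.decompose 𝒜 (w : A) n).2
  · refine ⟨(DirectSum.decompose 𝒜 (w : A)).support, Subtype.ext ?_⟩
    rw [AddSubmonoidClass.coe_finsetSum]
    exact DirectSum.sum_support_decompose 𝒜 (w : A)
  · have hw' : w ∈ J.submoduleOf I := (Submodule.Quotient.mk_eq_zero _).1 hw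
    have hw'' : idealProj 𝒜 hI n w ∈ J.submoduleOf I := hJ n hw'
    exact (Submodule.Quotient.mk_eq_zero _).2 hw''

theorem isInternal_centralSimpleGrading {z : A} (hz : z ∈ 𝒜 1) {s : ℕ} (f : Fin s → ℕ)
    (i : Fin s) : DirectSum.IsInternal (centralSimpleGrading 𝒜 z f i) :=
  isInternal_ideal_quotient 𝒜 (isHomogeneous_annPowAdd 𝒜 hz (f i))
    (isHomogeneous_annPowAdd 𝒜 hz (nextSize f i))

end CentralSimple

section TruncPoly

open Polynomial

variable {K : Type*} [Field K]

theorem mem_truncGrading {d n : ℕ} {x : TruncPoly K d} :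
    x ∈ truncGrading K d n ↔ ∃ r : K, Ideal.Quotient.mk _ (monomial n r) = x := by
  simp only [truncGrading, polyGrading, Submodule.mem_map, Submodule.mem_span_singleton]
  constructor
  · rintro ⟨_, ⟨r, rfl⟩, rfl⟩
    exact ⟨r, by rw [← smul_X_eq_monomial]; rfl⟩
  · rintro ⟨r, rfl⟩
    exact ⟨_, ⟨r, rfl⟩, by rw [← smul_X_eq_monomial]; rfl⟩

theorem mk_monomial_eq_zero {d n : ℕ} {r : K} :
    (Ideal.Quotient.mk (Ideal.span {(X : K[X]) ^ d}) (monomial n r) = 0) ↔ (n < d → r = 0) := by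
  rw [Ideal.Quotient.eq_zero_iff_mem, Ideal.mem_span_singleton, X_pow_dvd_iff]
  refine ⟨fun h hn => by simpa using h n hn, fun h m hm => ?_⟩
  rw [coeff_monomial]
  split_ifs with hnm
  · exact h (hnm ▸ hm)
  · rfl

theorem isInternal_truncGrading (d : ℕ) : DirectSum.IsInternal (truncGrading K d) := by
  refine isInternal_map (Ideal.Quotient.mkₐ K (Ideal.span {(X : K[X]) ^ d})).toLinearMap
    Ideal.Quotient.mk_surjective (polyGrading K) (fun n => monomial n ∘ₗ lcoeff K n)
    (fun n w hw => ?_) (fun m n hmn w hw => ?_) (fun n w => ?_) (fun w => ?_) (fun n w hw => ?_)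
  · obtain ⟨r, rfl⟩ := Submodule.mem_span_singleton.1 hw
    simp [smul_X_eq_monomial]
  · obtain ⟨r, rfl⟩ := Submodule.mem_span_singleton.1 hw
    simp [smul_X_eq_monomial, coeff_monomial, hmn]
  · exact Submodule.mem_span_singleton.2 ⟨w.coeff n, smul_X_eq_monomial⟩
  · exact ⟨w.support, w.sum_monomial_eq⟩
  · have hw' : (X : K[X]) ^ d ∣ w :=
      Ideal.mem_span_singleton.1 (Ideal.Quotient.eq_zero_iff_mem.1 hw)
    exact mk_monomial_eq_zero.2 fun hn => X_pow_dvd_iff.1 hw' n hn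

theorem lsmul_X_pow_mk_monomial {d : ℕ} (k n : ℕ) (r : K) :
    ((Algebra.lsmul K K (TruncPoly K d) (X : K[X])) ^ k)
      (Ideal.Quotient.mk _ (monomial n r)) = Ideal.Quotient.mk _ (monomial (n + k) r) := by
  rw [← map_pow, Algebra.lsmul_coe, ← X_pow_mul_monomial]
  rfl

/-- Multiplication by `t` is a Lefschetz operator on `K[t]/(t^d)`. -/
theorem isLefschetz_truncGrading {d : ℕ} (hd : 0 < d) :
    IsLefschetz (truncGrading K d) (d - 1) (Algebra.lsmul K K (TruncPoly K d) (X : K[X])) where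
  map_mem n x hx := by
    obtain ⟨r, rfl⟩ := mem_truncGrading.1 hx
    exact mem_truncGrading.2 ⟨r, by rw [← lsmul_X_pow_mk_monomial, pow_one]⟩
  le_of_ne_bot n hn := by
    obtain ⟨x, hx, hx0⟩ := Submodule.exists_mem_ne_zero_of_ne_bot hn
    obtain ⟨r, rfl⟩ := mem_truncGrading.1 hx
    rw [ne_eq, mk_monomial_eq_zero] at hx0
    by_contra hlt
    exact hx0 fun h => by omega
  bijOn n k hnk := by
    refine ⟨fun x hx => ?_, fun x hx y hy hxy => ?_, fun x hx => ?_⟩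
    · obtain ⟨r, rfl⟩ := mem_truncGrading.1 hx
      exact mem_truncGrading.2 ⟨r, (lsmul_X_pow_mk_monomial k n r).symm⟩
    · obtain ⟨r, rfl⟩ := mem_truncGrading.1 hx
      obtain ⟨r', rfl⟩ := mem_truncGrading.1 hy
      rw [lsmul_X_pow_mk_monomial, lsmul_X_pow_mk_monomial, ← sub_eq_zero, ← map_sub, ← map_sub,
        mk_monomial_eq_zero] at hxy
      rw [sub_eq_zero.1 (hxy (by omega))]
    · obtain ⟨r, rfl⟩ := mem_truncGrading.1 hx
      exact ⟨_, mem_truncGrading.2 ⟨r, rfl⟩, lsmul_X_pow_mk_monomial k n r⟩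

theorem finiteDimensional_truncPoly (d : ℕ) : FiniteDimensional K (TruncPoly K d) :=
  (monic_X_pow d).finite_quotient

end TruncPoly

/-! ### A common Lefschetz element -/

section Common

variable {K Ω : Type*} [Field K] [AddCommGroup Ω] [Module K Ω]

/-- For a linear family `ρ` of endomorphisms, the injectivity of `ρ g ^ k` on a subspace `W` is
implied by the non-vanishing of a polynomial in the coordinates of `g`. This polynomial can be
chosen non-zero if injectivity holds for at least one `g`. -/
theorem exists_polynomial_injOn {V : Type*} [AddCommGroup V] [Module K V] [FiniteDimensional K V]
    {σ : Type*} [Fintype σ] (b : Module.Basis σ K Ω) (ρ : Ω →ₗ[K] Module.End K V) (k : ℕ)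
    (W : Submodule K V) {g₀ : Ω} (hg₀ : ∀ x ∈ W, (ρ g₀ ^ k) x = 0 → x = 0) :
    ∃ P : MvPolynomial σ K, P ≠ 0 ∧ ∀ g, MvPolynomial.eval (b.repr g) P ≠ 0 →
      ∀ x ∈ W, (ρ g ^ k) x = 0 → x = 0 := by
  classical
  obtain ⟨L, hL⟩ := LinearMap.exists_leftInverse_of_injective ((ρ g₀ ^ k) ∘ₗ W.subtype)
    (LinearMap.ker_eq_bot'.2 fun x hx => Subtype.ext (hg₀ x x.2 hx))
  obtain ⟨p, hp⟩ := LinearMap.exists_leftInverse_of_injective W.subtype W.ker_subtype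
  let Q : Module.End K V := W.subtype ∘ₗ L
  let π : Module.End K V := W.subtype ∘ₗ p
  have hπ : ∀ x ∈ W, π x = x := fun x hx => congrArg Subtype.val (LinearMap.congr_fun hp ⟨x, hx⟩)
  -- This operator is the identity for `g = g₀`, and on `W` it factors through `ρ g ^ k`.
  let Ψ : Ω → Module.End K V := fun g => Q * ρ g ^ k * π + (1 - π)
  have hΨ₀ : Ψ g₀ = 1 := by
    have : Q * ρ g₀ ^ k * π = π := LinearMap.ext fun x =>
      congrArg Subtype.val (LinearMap.congr_fun hL (p x))
    simp only [Ψ, this, add_sub_cancel]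
  let e := LinearMap.toMatrixAlgEquiv (Module.finBasis K V)
  let C := (MvPolynomial.C (σ := σ) (R := K)).mapMatrix (m := Fin (Module.finrank K V))
  let P : MvPolynomial σ K :=
    (C (e Q) * (∑ i, (MvPolynomial.X i : MvPolynomial σ K) • C (e (ρ (b i)))) ^ k * C (e π) +
      C (1 - e π)).det
  have hP : ∀ g, MvPolynomial.eval (b.repr g) P = LinearMap.det (Ψ g) := by
    intro g
    have hC : ∀ M, (MvPolynomial.eval (b.repr g)).mapMatrix (C M) = M := fun M => by
      ext i j; simp [C]
    have hX : (MvPolynomial.eval (b.repr g)).mapMatrix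
        (∑ i, (MvPolynomial.X i : MvPolynomial σ K) • C (e (ρ (b i)))) = e (ρ g) := by
      conv_rhs => rw [← b.sum_repr g]
      rw [map_sum, map_sum, map_sum]
      refine Finset.sum_congr rfl fun i _ => ?_
      rw [map_smul ρ, map_smul e]
      ext j l
      simp [C]
    have hdet : LinearMap.det (Ψ g) = (e (Ψ g)).det := (LinearMap.det_toMatrix _ _).symm
    rw [hdet, RingHom.map_det, map_add, map_mul, map_mul, map_pow, hC, hC, hC, hX]
    simp [Ψ]
  refine ⟨P, fun h0 => ?_, fun g hg x hx hx0 => ?_⟩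
  · have := hP g₀
    rw [h0, hΨ₀, map_zero, map_one] at this
    exact zero_ne_one this
  · rw [hP] at hg
    refine (LinearMap.equivOfDetNeZero (Ψ g) hg).injective ?_
    change Ψ g x = Ψ g 0
    rw [map_zero]
    simp [Ψ, hπ x hx, hx0]

/-- Finitely many linear families of endomorphisms, for each of which a power of some member is
injective on a given subspace, have a common parameter for which all these powers are injective:
a product of finitely many non-zero polynomials over an infinite field has a non-zero. -/
theorem exists_common_injOn [Infinite K] [FiniteDimensional K Ω] {J : Type*} [Finite J]
    {V : J → Type*} [∀ j, AddCommGroup (V j)] [∀ j, Module K (V j)]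
    [∀ j, FiniteDimensional K (V j)] (ρ : ∀ j, Ω →ₗ[K] Module.End K (V j)) (k : J → ℕ)
    (W : ∀ j, Submodule K (V j)) (h : ∀ j, ∃ g, ∀ x ∈ W j, (ρ j g ^ k j) x = 0 → x = 0) :
    ∃ g, ∀ j, ∀ x ∈ W j, (ρ j g ^ k j) x = 0 → x = 0 := by
  cases nonempty_fintype J
  let b := Module.finBasis K Ω
  choose g₀ hg₀ using h
  choose P hP0 hP using fun j => exists_polynomial_injOn b (ρ j) (k j) (W j) (hg₀ j)
  obtain ⟨x, hx⟩ : ∃ x, MvPolynomial.eval x (∏ j, P j) ≠ 0 := by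
    by_contra hcon
    push Not at hcon
    exact Finset.prod_ne_zero_iff.2 (fun j _ => hP0 j)
      (MvPolynomial.funext fun x => by rw [hcon x, map_zero])
  refine ⟨b.equivFun.symm x, fun j => hP j _ ?_⟩
  rw [map_prod] at hx
  have := Finset.prod_ne_zero_iff.1 hx j (Finset.mem_univ j)
  have hrepr : ⇑(b.repr (b.equivFun.symm x)) = x := b.equivFun.apply_symm_apply x
  rwa [hrepr]

end Common

/-! ### Symmetry of the central simple modules -/

section Jordan

variable {K : Type*} [Field K]

theorem HasJordanBlockSizes.finiteDimensional {V : Type*} [AddCommGroup V] [Module K V]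
    {T : V →ₗ[K] V} {s : ℕ} {f m : Fin s → ℕ} (h : HasJordanBlockSizes T f m) :
    FiniteDimensional K V := by
  obtain ⟨b, -⟩ := h.exists_basis
  exact Module.Finite.of_basis b

/-- There is no Jordan block whose size lies strictly between `f_{i+1}` and `f_i`. -/
theorem HasJordanBlockSizes.colon_le {A : Type*} [CommRing A] [Algebra K A] {z : A} {s : ℕ}
    {f m : Fin s → ℕ} (h : HasJordanBlockSizes (LinearMap.mulLeft K z) f m) (i : Fin s) {x : A}
    (hx : z ^ (f i - 1) * x = 0) : x ∈ annPowAdd z (nextSize f i) := by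
  obtain ⟨b, hb⟩ := h.exists_basis
  -- Multiplication by `z` shifts coordinates along the Jordan blocks.
  have shift : ∀ (j : Fin s) (l : Fin (m j)) (k : ℕ) (hk : k + 1 < f j) (y : A),
      b.repr (z * y) ⟨j, l, ⟨k + 1, hk⟩⟩ = b.repr y ⟨j, l, ⟨k, by omega⟩⟩ := by
    intro j l k hk y
    have : (b.coord ⟨j, l, ⟨k + 1, hk⟩⟩) ∘ₗ LinearMap.mulLeft K z =
        b.coord ⟨j, l, ⟨k, by omega⟩⟩ := by
      refine b.ext fun ⟨j', l', k'⟩ => ?_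
      rw [LinearMap.comp_apply, hb]
      by_cases hk' : (k' : ℕ) + 1 < f j'
      · rw [dif_pos hk', Module.Basis.coord_apply, Module.Basis.coord_apply,
          Module.Basis.repr_self, Module.Basis.repr_self, Finsupp.single_apply,
          Finsupp.single_apply]
        refine if_congr ?_ rfl rfl
        constructor
        · intro he
          obtain ⟨rfl, he⟩ := Sigma.mk.inj_iff.1 he
          have he := eq_of_heq he
          simp only [Prod.mk.injEq, Fin.mk.injEq] at he
          obtain ⟨rfl, he⟩ := he
          congr 2
          exact Fin.ext (by simpa using he)
        · intro he
          obtain ⟨rfl, he⟩ := Sigma.mk.inj_iff.1 he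
          have he := eq_of_heq he
          simp only [Prod.mk.injEq] at he
          obtain ⟨rfl, rfl⟩ := he
          rfl
      · rw [dif_neg hk', map_zero, Module.Basis.coord_apply, Module.Basis.repr_self,
          Finsupp.single_apply, if_neg]
        intro he
        obtain ⟨rfl, he⟩ := Sigma.mk.inj_iff.1 he
        have he := eq_of_heq he
        simp only [Prod.mk.injEq] at he
        obtain ⟨rfl, rfl⟩ := he
        exact hk' hk
    exact LinearMap.congr_fun this y
  have shift_pow : ∀ (j : Fin s) (l : Fin (m j)) (r : ℕ) (hr : r < f j) (y : A),
      b.repr (z ^ r * y) ⟨j, l, ⟨r, hr⟩⟩ = b.repr y ⟨j, l, ⟨0, by omega⟩⟩ := by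
    intro j l r
    induction r with
    | zero => intro hr y; simp
    | succ r ih => intro hr y; rw [pow_succ', mul_assoc, shift, ih (by omega)]
  have killed : ∀ (j : Fin s) (l : Fin (m j)) (k : Fin (f j)) (r : ℕ), f j ≤ k + r →
      z ^ r * b ⟨j, l, k⟩ = 0 := by
    intro j l k r
    induction r generalizing k with
    | zero => intro hr; have := k.2; omega
    | succ r ih =>
      intro hr
      have hz := hb j l k
      rw [LinearMap.mulLeft_apply] at hz
      rw [pow_succ, mul_assoc, hz]
      split_ifs with hk
      · exact ih _ (by simp only; omega)
      · exact mul_zero _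
  rw [← b.sum_repr x]
  refine sum_mem fun ⟨j, l, k⟩ _ => ?_
  rw [← algebraMap_smul A, smul_eq_mul]
  obtain ⟨k, hk⟩ := k
  cases k with
  | succ k =>
    refine Ideal.mul_mem_left _ _ (Submodule.mem_sup_right (Ideal.mem_span_singleton.2
      ⟨b ⟨j, l, ⟨k, by omega⟩⟩, ?_⟩))
    have := hb j l ⟨k, by omega⟩
    rw [dif_pos hk] at this
    exact this.symm
  | zero =>
    rcases le_or_gt j i with hji | hij
    · have hfj : f i ≤ f j := h.strictAnti.antitone hji
      have hpos := h.size_pos i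
      have := shift_pow j l (f i - 1) (by omega) x
      rw [hx, map_zero, Finsupp.zero_apply] at this
      rw [← this, map_zero, zero_mul]
      exact zero_mem _
    · refine Ideal.mul_mem_left _ _ (Submodule.mem_sup_left ?_)
      rw [Submodule.mem_colon_singleton, Submodule.mem_bot, smul_eq_mul, mul_comm]
      refine killed _ _ _ _ ?_
      have hlt : (i : ℕ) + 1 < s := by have := j.2; omega
      rw [nextSize, dif_pos hlt, Nat.zero_add]
      exact h.strictAnti.antitone (Fin.le_def.2 hij)

theorem centralSimpleGrading_ne_bot_iff {A : Type*} [CommRing A] [Algebra K A]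
    (𝒜 : ℕ → Submodule K A) {z : A} {s : ℕ} {f : Fin s → ℕ} {i : Fin s} {n : ℕ} :
    centralSimpleGrading 𝒜 z f i n ≠ ⊥ ↔
      ∃ x ∈ 𝒜 n, x ∈ annPowAdd z (f i) ∧ x ∉ annPowAdd z (nextSize f i) := by
  rw [Submodule.ne_bot_iff]
  constructor
  · rintro ⟨_, ⟨x, hx, rfl⟩, hx0⟩
    exact ⟨x, hx, x.2, fun h => hx0 ((Submodule.Quotient.mk_eq_zero _).2 h)⟩
  · rintro ⟨x, hx, hxI, hxJ⟩
    refine ⟨_, ⟨⟨x, hxI⟩, hx, rfl⟩, fun h => hxJ ?_⟩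
    have h' : (⟨x, hxI⟩ : annPowAdd z (f i)) ∈
        (annPowAdd z (nextSize f i)).submoduleOf (annPowAdd z (f i)) :=
      (Submodule.Quotient.mk_eq_zero _).1 h
    exact h'

end Jordan

section Gorenstein

variable {K A : Type*} [Field K] [CommRing A] [Algebra K A] (𝒜 : ℕ → Submodule K A)
  [GradedAlgebra 𝒜]

theorem mem_socle {x : A} : x ∈ socle K 𝒜 ↔ ∀ n, 0 < n → ∀ y ∈ 𝒜 n, x * y = 0 := by
  classical
  rw [socle, Submodule.mem_colon]
  simp only [smul_eq_mul, Submodule.mem_bot]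
  constructor
  · intro h n hn y hy
    refine h y ?_
    change y ∈ HomogeneousIdeal.irrelevant 𝒜
    rw [HomogeneousIdeal.mem_irrelevant_iff, GradedRing.proj_apply]
    exact DirectSum.decompose_of_mem_ne 𝒜 hy hn.ne'
  · intro h y hy
    have hy0 : (DirectSum.decompose 𝒜 y 0 : A) = 0 := hy
    rw [← DirectSum.sum_support_decompose 𝒜 y, Finset.mul_sum]
    refine Finset.sum_eq_zero fun n _ => ?_
    rcases Nat.eq_zero_or_pos n with rfl | hn
    · rw [hy0, mul_zero]
    · exact h n hn _ (DirectSum.decompose 𝒜 y n).2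

theorem exists_degree_bound [FiniteDimensional K A] : ∃ N, ∀ n, 𝒜 n ≠ ⊥ → n ≤ N := by
  have hind : iSupIndep 𝒜 := (DirectSum.Decomposition.isInternal 𝒜).submodule_iSupIndep
  have hfin := WellFoundedGT.finite_ne_bot_of_iSupIndep hind
  obtain ⟨N, hN⟩ := hfin.bddAbove
  exact ⟨N, fun n hn => hN hn⟩

/-- The socle of a graded Gorenstein algebra is concentrated in one degree `c`, and every non-zero
homogeneous element has a homogeneous multiple that spans the socle. -/
theorem exists_socle_degree [FiniteDimensional K A] (hgor : IsArtinianGorenstein K 𝒜) :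
    ∃ (c : ℕ) (σ : A), σ ≠ 0 ∧ (∀ x ∈ socle K 𝒜, ∃ r : K, r • σ = x) ∧ σ ∈ 𝒜 c ∧
      ∀ n, ∀ x ∈ 𝒜 n, x ≠ 0 → n ≤ c ∧ ∃ y ∈ 𝒜 (c - n), x * y ∈ socle K 𝒜 ∧ x * y ≠ 0 := by
  obtain ⟨N, hN⟩ := exists_degree_bound 𝒜
  -- A non-zero homogeneous multiple of maximal degree lies in the socle.
  have key : ∀ d n, N < n + d → ∀ x ∈ 𝒜 n, x ≠ 0 →
      ∃ k, ∃ y ∈ 𝒜 k, x * y ∈ socle K 𝒜 ∧ x * y ≠ 0 := by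
    intro d
    induction d with
    | zero =>
      intro n hn x hx hx0
      have := hN n fun h0 => hx0 (by rwa [h0, Submodule.mem_bot] at hx)
      omega
    | succ d ih =>
      intro n hn x hx hx0
      by_cases hs : x ∈ socle K 𝒜
      · exact ⟨0, 1, SetLike.one_mem_graded 𝒜, by rwa [mul_one], by rwa [mul_one]⟩
      · rw [mem_socle] at hs
        push Not at hs
        obtain ⟨k, hk, y, hy, hxy⟩ := hs
        obtain ⟨l, w, hw, hw1, hw2⟩ := ih (n + k) (by omega) _ (SetLike.mul_mem_graded hx hy) hxy
        exact ⟨k + l, y * w, SetLike.mul_mem_graded hy hw, by rwa [← mul_assoc],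
          by rwa [← mul_assoc]⟩
  have hA : (1 : A) ≠ 0 := by
    intro h1
    have := hgor.2
    have hsub : Subsingleton A := subsingleton_of_zero_eq_one h1.symm
    rw [Module.finrank_zero_of_subsingleton] at this
    exact zero_ne_one this
  obtain ⟨c, σ, hσ, hσs, hσ0⟩ := key (N + 1) 0 (by omega) 1 (SetLike.one_mem_graded 𝒜) hA
  rw [one_mul] at hσs hσ0
  have hspan : ∀ x ∈ socle K 𝒜, ∃ r : K, r • σ = x := by
    intro x hx
    obtain ⟨r, hr⟩ := exists_smul_eq_of_finrank_eq_one hgor.2 (x := ⟨σ, hσs⟩)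
      (fun h => hσ0 (congrArg Subtype.val h)) ⟨x, hx⟩
    exact ⟨r, congrArg Subtype.val hr⟩
  refine ⟨c, σ, hσ0, hspan, hσ, fun n x hx hx0 => ?_⟩
  obtain ⟨k, y, hy, hxy, hxy0⟩ := key (N + 1) n (by omega) x hx hx0
  have hnk : n + k = c := by
    obtain ⟨r, hr⟩ := hspan _ hxy
    have h1 : x * y ∈ 𝒜 (n + k) := SetLike.mul_mem_graded hx hy
    have h2 : x * y ∈ 𝒜 c := hr ▸ Submodule.smul_mem _ r hσ
    exact DirectSum.degree_eq_of_mem_mem 𝒜 h1 h2 hxy0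
  exact ⟨by omega, y, by rwa [show c - n = k by omega], hxy, hxy0⟩

/-- The double annihilator property of principal ideals of a Gorenstein algebra: the bilinear form
`(x, y) ↦ φ (x y)`, with `φ` a functional supported in the socle degree, is nondegenerate, so that
every functional that vanishes on the ideal is of the form `φ (y ·)`. -/
theorem exists_annihilator_of_notMem_span [FiniteDimensional K A]
    (hgor : IsArtinianGorenstein K 𝒜) {v w : A} (hv : v ∉ Ideal.span {w}) :
    ∃ y, y * w = 0 ∧ y * v ≠ 0 := by
  classical
  obtain ⟨c, σ, hσ0, hspan, hσ, hc⟩ := exists_socle_degree 𝒜 hgor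
  obtain ⟨τ, hτ⟩ := Module.Projective.exists_dual_ne_zero K hσ0
  let φ : A →ₗ[K] K := τ ∘ₗ GradedAlgebra.proj 𝒜 c
  let B : A →ₗ[K] Module.Dual K A := (LinearMap.mul K A).compr₂ φ
  have hB : ∀ x y, B x y = φ (x * y) := fun x y => rfl
  have hinj : Function.Injective B := by
    rw [injective_iff_map_eq_zero]
    intro y hy
    by_contra hy0
    obtain ⟨n, hn⟩ : ∃ n, (DirectSum.decompose 𝒜 y n : A) ≠ 0 := by
      by_contra hcon
      push Not at hcon
      exact hy0 (by rw [← DirectSum.sum_support_decompose 𝒜 y,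
        Finset.sum_eq_zero fun n _ => hcon n])
    obtain ⟨hnc, h, hh, hs, hs0⟩ := hc n _ (DirectSum.decompose 𝒜 y n).2 hn
    obtain ⟨r, hr⟩ := hspan _ hs
    have h1 : φ (y * h) = τ (DirectSum.decompose 𝒜 y n * h) := by
      change τ (DirectSum.decompose 𝒜 (y * h) c : A) = _
      conv_lhs => rw [← Nat.add_sub_of_le hnc]
      rw [DirectSum.coe_decompose_mul_add_of_right_mem 𝒜 hh]
    rw [← hB, hy, LinearMap.zero_apply, ← hr, map_smul, smul_eq_mul, eq_comm, mul_eq_zero] at h1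
    rcases h1 with h1 | h1
    · exact hs0 (by rw [← hr, h1, zero_smul])
    · exact hτ h1
  have hsurj : Function.Surjective B :=
    (LinearMap.injective_iff_surjective_of_finrank_eq_finrank Subspace.dual_finrank_eq.symm).1 hinj
  obtain ⟨χ, hχv, hχ⟩ := Submodule.exists_le_ker_of_notMem
    (p := (Ideal.span {w}).restrictScalars K) hv
  obtain ⟨y, rfl⟩ := hsurj χ
  refine ⟨y, hinj (LinearMap.ext fun x => ?_), fun h0 => hχv (by rw [hB, h0, map_zero])⟩
  rw [map_zero, LinearMap.zero_apply, hB, mul_assoc, ← hB]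
  exact hχ (Ideal.mul_mem_right _ _ (Ideal.mem_span_singleton_self w))

/-- The pairing `(x, y) ↦ φ (z ^ (f_i - 1) x y)` identifies the degree `p` piece of `U_i` with the
dual of the piece of degree `c - (f_i - 1) - p`, where `c` is the socle degree of `A`. In
particular these two pieces vanish simultaneously. -/
theorem exists_dual_degree (hgor : IsArtinianGorenstein K 𝒜) {z : A} (hz : z ∈ 𝒜 1) {s : ℕ}
    {f m : Fin s → ℕ} (hf : HasJordanBlockSizes (LinearMap.mulLeft K z) f m) :
    ∃ c : ℕ, ∀ i p, centralSimpleGrading 𝒜 z f i p ≠ ⊥ →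
      ∃ q, centralSimpleGrading 𝒜 z f i q ≠ ⊥ ∧ p + q + (f i - 1) = c := by
  classical
  have := hf.finiteDimensional
  obtain ⟨c, -, -, -, -, hc⟩ := exists_socle_degree 𝒜 hgor
  refine ⟨c, fun i p hp => ?_⟩
  obtain ⟨d, hd⟩ : ∃ d, f i = d + 1 := ⟨f i - 1, by have := hf.size_pos i; omega⟩
  have hnext : nextSize f i ≤ d := by
    rw [nextSize]
    split_ifs with h
    · have : f ⟨i + 1, h⟩ < f i := hf.strictAnti (Fin.lt_def.2 (Nat.lt_succ_self _))
      omega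
    · omega
  have hzJ : ∀ k, Ideal.span {z} ≤ annPowAdd z k := fun k => le_sup_right
  have mem_colon : ∀ k x, x ∈ (⊥ : Ideal A).colon {z ^ k} ↔ x * z ^ k = 0 := fun k x => by
    rw [Submodule.mem_colon_singleton, Submodule.mem_bot, smul_eq_mul]
  obtain ⟨x, hx, hxI, hxJ⟩ := (centralSimpleGrading_ne_bot_iff 𝒜).1 hp
  rw [hd] at hxI
  -- Modulo `(z)`, the class of `x` is represented by an element `u` of `0 : z ^ f_i` of degree `p`.
  obtain ⟨u', hu', w', hw', rfl⟩ := Submodule.mem_sup.1 hxI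
  have hu := isHomogeneous_colon_pow 𝒜 hz (d + 1) p hu'
  have hw := Ideal.homogeneous_span 𝒜 {z} (fun y hy => ⟨1, by rwa [Set.mem_singleton_iff.1 hy]⟩)
    p hw'
  have hup := (DirectSum.decompose 𝒜 u' p).2
  have huJ : (DirectSum.decompose 𝒜 u' p : A) ∉ annPowAdd z (nextSize f i) := fun h => by
    refine hxJ ?_
    rw [← DirectSum.decompose_of_mem_same 𝒜 hx, DirectSum.decompose_add, DirectSum.add_apply,
      Submodule.coe_add]
    exact add_mem h (hzJ _ hw)
  set u : A := ((DirectSum.decompose 𝒜 u' p : 𝒜 p) : A)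
  rw [mem_colon] at hu
  have hv : z ^ d * u ∉ Ideal.span {z ^ (d + 1)} := fun h => by
    obtain ⟨w, hw⟩ := Ideal.mem_span_singleton.1 h
    refine huJ ?_
    rw [← sub_add_cancel u (z * w)]
    refine add_mem (hf.colon_le i ?_) (hzJ _ (Ideal.mul_mem_right _ _
      (Ideal.mem_span_singleton_self z)))
    rw [hd, Nat.add_sub_cancel, mul_sub, hw, pow_succ, mul_assoc, sub_self]
  obtain ⟨y, hy, hyv⟩ := exists_annihilator_of_notMem_span 𝒜 hgor hv
  obtain ⟨n, hn⟩ : ∃ n, (DirectSum.decompose 𝒜 y n : A) * (z ^ d * u) ≠ 0 := by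
    by_contra hcon
    push Not at hcon
    exact hyv (by rw [← DirectSum.sum_support_decompose 𝒜 y, Finset.sum_mul,
      Finset.sum_eq_zero fun n _ => hcon n])
  have hyn := isHomogeneous_colon_pow 𝒜 hz (d + 1) n ((mem_colon _ _).2 hy)
  rw [mem_colon] at hyn
  have hynn := (DirectSum.decompose 𝒜 y n).2
  set yn : A := ((DirectSum.decompose 𝒜 y n : 𝒜 n) : A)
  have hzd : z ^ d ∈ 𝒜 d := by simpa using SetLike.pow_mem_graded d hz
  obtain ⟨hle, h, hh, -, hne⟩ := hc _ _ (SetLike.mul_mem_graded hynn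
    (SetLike.mul_mem_graded hzd hup)) hn
  refine ⟨_, (centralSimpleGrading_ne_bot_iff 𝒜).2 ⟨yn * h, SetLike.mul_mem_graded hynn hh,
    ?_, fun hJ => hne ?_⟩, ?_⟩
  · rw [hd]
    refine Submodule.mem_sup_left ((mem_colon _ _).2 ?_)
    rw [mul_right_comm, hyn, zero_mul]
  · obtain ⟨α, hα, β', hβ', hsum⟩ := Submodule.mem_sup.1 hJ
    obtain ⟨β, rfl⟩ := Ideal.mem_span_singleton.1 hβ'
    rw [mem_colon] at hα
    have hα' : α * z ^ d = 0 := by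
      rw [← Nat.add_sub_of_le hnext, pow_add, ← mul_assoc, hα, zero_mul]
    calc yn * (z ^ d * u) * h = yn * h * (z ^ d * u) := by ring
      _ = α * z ^ d * u + β * (u * z ^ (d + 1)) := by rw [← hsum]; ring
      _ = 0 := by rw [hα', hu, zero_mul, mul_zero, add_zero]
  · omega

end Gorenstein

/-! ### The strong Lefschetz property and Lefschetz operators -/

section SLP

variable {K V : Type*} [Field K] [AddCommGroup V] [Module K V]

theorem IsLefschetz.ne_bot_symm {𝒱 : ℕ → Submodule K V} {c : ℕ} {E : Module.End K V}
    (h : IsLefschetz 𝒱 c E) {n : ℕ} (hn : 𝒱 n ≠ ⊥) : 𝒱 (c - n) ≠ ⊥ := by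
  have hnc := h.le_of_ne_bot n hn
  obtain ⟨x, hx, hx0⟩ := Submodule.exists_mem_ne_zero_of_ne_bot hn
  rw [Submodule.ne_bot_iff]
  rcases le_total (2 * n) c with hle | hle
  · have hb := h.bijOn n (c - 2 * n) (by omega)
    rw [show n + (c - 2 * n) = c - n by omega] at hb
    exact ⟨_, hb.mapsTo hx, fun h0 => hx0 (hb.injOn hx (zero_mem _) (by rw [h0, map_zero]))⟩
  · have hb := h.bijOn (c - n) (2 * n - c) (by omega)
    rw [show c - n + (2 * n - c) = n by omega] at hb
    obtain ⟨y, hy, rfl⟩ := hb.surjOn hx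
    exact ⟨y, hy, fun h0 => hx0 (by rw [h0, map_zero])⟩

variable {R : Type*} [CommRing R] [Algebra K R] [Module R V] [IsScalarTower K R V]

theorem lsmul_pow_apply (g : R) (k : ℕ) (x : V) :
    ((Algebra.lsmul K K V g) ^ k) x = g ^ k • x := by
  rw [← map_pow, Algebra.lsmul_coe]

/-- The strong Lefschetz property, reindexed by the centre `c = a + b`. -/
theorem HasSLP.exists_isLefschetz {ℛ : ℕ → Submodule K R} {𝒱 : ℕ → Submodule K V}
    (hmap : ∀ g ∈ ℛ 1, ∀ n, ∀ x ∈ 𝒱 n, g • x ∈ 𝒱 (n + 1)) (h : HasSLP ℛ 𝒱) :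
    ∃ a b : ℕ, 𝒱 a ≠ ⊥ ∧ 𝒱 b ≠ ⊥ ∧ (∀ n, 𝒱 n ≠ ⊥ → a ≤ n ∧ n ≤ b) ∧
      ∃ g ∈ ℛ 1, IsLefschetz 𝒱 (a + b) (Algebra.lsmul K K V g) := by
  obtain ⟨a, b, hab, ha, hb, hbd, g, hg, hbij⟩ := h
  refine ⟨a, b, ha, hb, hbd, g, hg, hmap g hg, fun n hn => by have := hbd n hn; omega,
    fun n k hnk => ?_⟩
  by_cases hna : a ≤ n
  · have := hbij (n - a) (by omega)
    rw [show a + (n - a) = n by omega, show b - (n - a) = n + k by omega,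
      show b - a - 2 * (n - a) = k by omega] at this
    exact this.congr fun x _ => (lsmul_pow_apply g k x).symm
  · have h1 : 𝒱 n = ⊥ := by
      by_contra hn
      exact hna (hbd n hn).1
    have h2 : 𝒱 (n + k) = ⊥ := by
      by_contra hn
      have := (hbd _ hn).2
      omega
    rw [h1, h2]
    simp

theorem IsLefschetz.hasSLP {V : Type*} [AddCommGroup V] [Module K V] [Module R V]
    {ℛ : ℕ → Submodule K R} {𝒱 : ℕ → Submodule K V} {c : ℕ}
    {E : Module.End K V} (h : IsLefschetz 𝒱 c E) (hne : ∃ n, 𝒱 n ≠ ⊥) {g : R} (hg : g ∈ ℛ 1)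
    (hE : ∀ x, E x = g • x) : HasSLP ℛ 𝒱 := by
  classical
  have ha := Nat.find_spec hne
  have hmin : ∀ n, 𝒱 n ≠ ⊥ → Nat.find hne ≤ n := fun n hn => Nat.find_min' hne hn
  set a := Nat.find hne
  have hac := h.le_of_ne_bot a ha
  have hsymm := hmin _ (h.ne_bot_symm ha)
  refine ⟨a, c - a, hsymm, ha, h.ne_bot_symm ha, fun n hn => ⟨hmin n hn, ?_⟩, g, hg,
    fun i hi => ?_⟩
  · have h1 := h.le_of_ne_bot n hn
    have h2 := hmin _ (h.ne_bot_symm hn)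
    omega
  · have hb := h.bijOn (a + i) (c - a - a - 2 * i) (by omega)
    rw [show a + i + (c - a - a - 2 * i) = c - a - i by omega] at hb
    refine hb.congr fun x _ => ?_
    generalize c - a - a - 2 * i = k
    induction k with
    | zero => simp
    | succ k ih => rw [pow_succ', Module.End.mul_apply, ih, hE, pow_succ', mul_smul]

end SLP

section CommonLefschetz

variable {K Ω : Type*} [Field K] [Infinite K] [AddCommGroup Ω] [Module K Ω]
  [FiniteDimensional K Ω]

/-- Being a Lefschetz operator is an open condition, hence finitely many graded spaces that admit
Lefschetz elements have a common one. -/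
theorem exists_common_isLefschetz {ι : Type*} [Finite ι] {V : ι → Type*}
    [∀ i, AddCommGroup (V i)] [∀ i, Module K (V i)] [∀ i, FiniteDimensional K (V i)]
    (𝒱 : ∀ i, ℕ → Submodule K (V i)) (c : ι → ℕ) (ρ : ∀ i, Ω →ₗ[K] Module.End K (V i))
    (hmap : ∀ i g n, ∀ x ∈ 𝒱 i n, ρ i g x ∈ 𝒱 i (n + 1))
    (h : ∀ i, ∃ g, IsLefschetz (𝒱 i) (c i) (ρ i g)) :
    ∃ g, ∀ i, IsLefschetz (𝒱 i) (c i) (ρ i g) := by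
  choose g₀ hg₀ using h
  obtain ⟨g, hg⟩ := exists_common_injOn (J := Σ i, Fin (c i + 1)) (fun j => ρ j.1)
    (fun j => c j.1 - 2 * j.2) (fun j => 𝒱 j.1 j.2) fun ⟨i, n⟩ => by
      refine ⟨g₀ i, fun x hx hx0 => ?_⟩
      dsimp only at hx hx0
      rcases le_total (2 * (n : ℕ)) (c i) with hle | hle
      · exact ((hg₀ i).bijOn n (c i - 2 * n) (by omega)).injOn hx (zero_mem _)
          (by rw [hx0, map_zero])
      · rwa [Nat.sub_eq_zero_of_le hle, pow_zero, Module.End.one_apply] at hx0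
  refine ⟨g, fun i => ⟨hmap i g, (hg₀ i).le_of_ne_bot, fun n k hnk => ?_⟩⟩
  have hpow : ∀ j, ∀ x ∈ 𝒱 i n, (ρ i g ^ j) x ∈ 𝒱 i (n + j) := by
    intro j x hx
    induction j with
    | zero => simpa
    | succ j ih => rw [pow_succ', Module.End.mul_apply]; exact hmap i g _ _ ih
  refine bijOn_of_finrank_eq _ _ _ (hpow k) (fun x hx hx0 => ?_) ?_
  · refine hg ⟨i, ⟨n, by omega⟩⟩ x hx ?_
    rwa [← show k = c i - 2 * n by omega]
  · have hb := (hg₀ i).bijOn n k hnk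
    refine LinearEquiv.finrank_eq (LinearEquiv.ofBijective
      ((ρ i (g₀ i) ^ k).restrict fun x hx => hb.mapsTo hx) ⟨fun x y hxy => ?_, fun y => ?_⟩)
    · exact Subtype.ext (hb.injOn x.2 y.2 (congrArg Subtype.val hxy))
    · obtain ⟨x, hx, hxy⟩ := hb.surjOn y.2
      exact ⟨⟨x, hx⟩, Subtype.ext hxy⟩

end CommonLefschetz

section Action

variable {K : Type*} [Field K]

theorem tensorAction_add {A B M N : Type*} [CommRing A] [Algebra K A] [CommRing B] [Algebra K B]
    [AddCommGroup M] [Module K M] [Module A M] [IsScalarTower K A M] [AddCommGroup N] [Module K N]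
    [Module B N] [IsScalarTower K B N] (a : A) (b : B) :
    tensorAction M N A B (a ⊗ₜ 1 + 1 ⊗ₜ b) =
      tensorSum (Algebra.lsmul K K M a) (Algebra.lsmul K K N b) := by
  ext x y
  simp [tensorSum_tmul, tensorAction_tmul]

theorem add_mem_tensorGrading_one {A : Type*} [CommRing A] [Algebra K A]
    {𝒜 : ℕ → Submodule K A} [GradedAlgebra 𝒜] {g : A} (hg : g ∈ 𝒜 1) :
    g ⊗ₜ[K] (1 : K[X]) + (1 : A) ⊗ₜ[K] Polynomial.X ∈ tensorGrading 𝒜 (polyGrading K) 1 := by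
  have key : ∀ p q : ℕ, p + q = 1 → Submodule.map₂ (TensorProduct.mk K A K[X]) (𝒜 p)
      (polyGrading K q) ≤ tensorGrading 𝒜 (polyGrading K) 1 := fun p q hpq =>
    le_iSup₂_of_le (f := fun (r : ℕ × ℕ) _ => Submodule.map₂ (TensorProduct.mk K A K[X])
      (𝒜 r.1) (polyGrading K r.2)) (p, q) (Finset.HasAntidiagonal.mem_antidiagonal.2 hpq) le_rfl
  refine add_mem (key 1 0 rfl (Submodule.apply_mem_map₂ _ hg ?_))
    (key 0 1 rfl (Submodule.apply_mem_map₂ _ (SetLike.one_mem_graded 𝒜) ?_))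
  · exact Submodule.mem_span_singleton.2 ⟨1, by simp⟩
  · exact Submodule.mem_span_singleton.2 ⟨1, by simp⟩

theorem smul_mem_centralSimpleGrading {A : Type*} [CommRing A] [Algebra K A]
    {𝒜 : ℕ → Submodule K A} [GradedAlgebra 𝒜] {z : A} {s : ℕ} (f : Fin s → ℕ) (i : Fin s) {g : A}
    (hg : g ∈ 𝒜 1) (n : ℕ) (x : CentralSimpleModule z f i)
    (hx : x ∈ centralSimpleGrading 𝒜 z f i n) : g • x ∈ centralSimpleGrading 𝒜 z f i (n + 1) := by
  obtain ⟨y, hy, rfl⟩ := hx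
  refine ⟨g • y, ?_, rfl⟩
  have : g * (y : A) ∈ 𝒜 (1 + n) := SetLike.mul_mem_graded hg hy
  rwa [add_comm] at this

theorem finiteDimensional_ideal_quotient {A : Type*} [CommRing A] [Algebra K A]
    [FiniteDimensional K A] (I J : Ideal A) : FiniteDimensional K (I ⧸ J.submoduleOf I) := by
  have : FiniteDimensional K I :=
    inferInstanceAs (FiniteDimensional K (I.restrictScalars K))
  infer_instance

end Action

/-! ### The strong Lefschetz property of the associated module -/

/-- Let `U i` be finitely many graded modules over a graded algebra `A` with the strong Lefschetz
property, and suppose that the set of degrees in which `U i` is non-zero is stable under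
`p ↦ c - (f i - 1) - p`, so that all `U i ⊗ K[t]/(t ^ f i)` are centred at the same `c / 2`. Then the
direct sum of these modules has the strong Lefschetz property. -/
theorem hasSLP_directSum_tensor_truncPoly {K : Type*} [Field K] [CharZero K] {A : Type*}
    [CommRing A] [Algebra K A] {𝒜 : ℕ → Submodule K A} [GradedAlgebra 𝒜]
    (hfin : Module.Finite K (𝒜 1)) {ι : Type*} [Finite ι] [Nonempty ι] {U : ι → Type*}
    [∀ i, AddCommGroup (U i)] [∀ i, Module K (U i)] [∀ i, Module A (U i)]
    [∀ i, IsScalarTower K A (U i)] [∀ i, FiniteDimensional K (U i)]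
    {𝒰 : ∀ i, ℕ → Submodule K (U i)} (hint : ∀ i, DirectSum.IsInternal (𝒰 i))
    (hmap : ∀ i, ∀ g ∈ 𝒜 1, ∀ n, ∀ x ∈ 𝒰 i n, g • x ∈ 𝒰 i (n + 1))
    (hU : ∀ i, HasSLP 𝒜 (𝒰 i)) {f : ι → ℕ} (hf : ∀ i, 0 < f i) {c : ℕ}
    (hc : ∀ i p, 𝒰 i p ≠ ⊥ → ∃ q, 𝒰 i q ≠ ⊥ ∧ p + q + (f i - 1) = c) :
    HasSLP (tensorGrading 𝒜 (polyGrading K))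
      (directSumGrading (M := fun i => ExternalTensor K (U i) (TruncPoly K (f i)))
        (fun i => tensorGrading (𝒰 i) (truncGrading K (f i)))) := by
  classical
  have hSfin := fun d => finiteDimensional_truncPoly (K := K) d
  choose a b ha hb hbd g₀ hg₀ hL₀ using fun i => (hU i).exists_isLefschetz (hmap i)
  -- The lowest and highest degrees of `U i` are exchanged by `p ↦ c - (f i - 1) - p`.
  have hab : ∀ i, a i + b i + (f i - 1) = c := fun i => by
    obtain ⟨q, hq, hqc⟩ := hc i _ (ha i)
    obtain ⟨q', hq', hqc'⟩ := hc i _ (hb i)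
    have h1 := hbd i q hq
    have h2 := hbd i q' hq'
    omega
  obtain ⟨⟨g, hg⟩, hL⟩ := exists_common_isLefschetz 𝒰 (fun i => a i + b i)
    (fun i => (Algebra.lsmul K K (U i)).toLinearMap ∘ₗ (𝒜 1).subtype)
    (fun i g n x hx => hmap i g g.2 n x hx) fun i => ⟨⟨g₀ i, hg₀ i⟩, hL₀ i⟩
  have hT : ∀ i, ∃ H F : Module.End K (ExternalTensor K (U i) (TruncPoly K (f i))),
      IsGradedSl2 (tensorGrading (𝒰 i) (truncGrading K (f i))) c H
        (tensorSum (Algebra.lsmul K K (U i) g)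
          (Algebra.lsmul K K (TruncPoly K (f i)) (Polynomial.X : K[X]))) F := fun i => by
    obtain ⟨H, F, h⟩ := (hL i).exists_isGradedSl2 (hint i)
    obtain ⟨H', F', h'⟩ := (isLefschetz_truncGrading (K := K)
      (hf i)).exists_isGradedSl2 (isInternal_truncGrading (f i))
    have := h.tensor h'
    rw [hab i] at this
    exact ⟨_, _, this⟩
  choose H F hHF using hT
  have hTfin : ∀ i, FiniteDimensional K (ExternalTensor K (U i) (TruncPoly K (f i))) := fun i =>
    inferInstanceAs (FiniteDimensional K (U i ⊗[K] TruncPoly K (f i)))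
  have hD := IsGradedSl2.directSum hHF
  refine IsLefschetz.hasSLP (V := ⨁ i, ExternalTensor K (U i) (TruncPoly K (f i)))
    hD.isLefschetz ?_ (add_mem_tensorGrading_one hg) fun x => DFinsupp.ext fun i => ?_
  · obtain ⟨i⟩ := ‹Nonempty ι›
    obtain ⟨x, -, hx0⟩ := Submodule.exists_mem_ne_zero_of_ne_bot (ha i)
    have hUi : Nontrivial (U i) := nontrivial_of_ne x 0 hx0
    have hSi : Nontrivial (TruncPoly K (f i)) := by
      refine nontrivial_of_ne (Ideal.Quotient.mk _ (Polynomial.monomial 0 1)) 0 fun h0 => ?_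
      exact one_ne_zero (mk_monomial_eq_zero.1 h0 (hf i))
    have hTi : Nontrivial (ExternalTensor K (U i) (TruncPoly K (f i))) :=
      inferInstanceAs (Nontrivial (U i ⊗[K] TruncPoly K (f i)))
    have hDi : Nontrivial (⨁ i, ExternalTensor K (U i) (TruncPoly K (f i))) :=
      (DirectSum.of_injective (β := fun i => ExternalTensor K (U i) (TruncPoly K (f i)))
        i).nontrivial
    exact IsGradedSl2.exists_ne_bot (V := ⨁ i, ExternalTensor K (U i) (TruncPoly K (f i))) hD
  · exact (LinearMap.congr_fun (tensorAction_add (K := K) g (Polynomial.X : K[X])) (x i)).symm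

end CSM

theorem mainTheorem5 {K : Type*} [Field K] [CharZero K] {A : Type*} [CommRing A] [Algebra K A]
    (𝒜 : ℕ → Submodule K A) [GradedAlgebra 𝒜] (hstd : CSM.IsStandardGraded K 𝒜)
    (hgor : CSM.IsArtinianGorenstein K 𝒜) (z : A) (hz : z ∈ 𝒜 1)
    {s : ℕ} (f m : Fin s → ℕ) (hf : CSM.HasJordanBlockSizes (LinearMap.mulLeft K z) f m)
    (hU : ∀ i : Fin s, CSM.HasSLP 𝒜 (CSM.centralSimpleGrading 𝒜 z f i)) :
    CSM.HasSLP (CSM.tensorGrading 𝒜 (CSM.polyGrading K))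
      (CSM.directSumGrading (M := fun i : Fin s => CSM.TildeModule K z f i)
        (fun i => CSM.tildeGrading 𝒜 z f i)) := by
  have hA := hf.finiteDimensional
  have hUfin : ∀ i, FiniteDimensional K (CSM.CentralSimpleModule z f i) := fun i =>
    CSM.finiteDimensional_ideal_quotient _ _
  obtain ⟨c, hc⟩ := CSM.exists_dual_degree 𝒜 hgor hz hf
  -- Since `A ≠ 0`, there is at least one Jordan block.
  have hs : Nonempty (Fin s) := by
    by_contra hs
    rw [not_nonempty_iff] at hs
    obtain ⟨b, -⟩ := hf.exists_basis
    have hsub : Subsingleton A := b.repr.toEquiv.subsingleton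
    have h1 := hgor.2
    rw [Module.finrank_zero_of_subsingleton] at h1
    exact zero_ne_one h1
  exact CSM.hasSLP_directSum_tensor_truncPoly hstd.finite_one
    (fun i => CSM.isInternal_centralSimpleGrading 𝒜 hz f i)
    (fun i g hg n x hx => CSM.smul_mem_centralSimpleGrading f i hg n x hx) hU hf.size_pos hc
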